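/- Let $X$ be an elliptic curve over the finite field $\mathbb{F}_q$ with $q$ elements, and let $X' = X\otimes_{\mathbb{F}_q}\mathbb{F}_{q^2}$ be its base change to $\mathbb{F}_{q^2}$. For $Y = X$ or $Y = X'$, let $\mathrm{Cl}^0\,Y$ be the group of divisor classes of degree $0$ on $Y$, that is, the divisors of degree $0$ modulo the divisors of nonzero rational functions. Then pull-back of divisors induces an injective homomorphism $\mathrm{Cl}^0 X\to \mathrm{Cl}^0 X'$, by which $\mathrm{Cl}^0 X$ is regarded as a subgroup of $\mathrm{Cl}^0 X'$; the class number $h=\#\mathrm{Cl}^0 X$ and the index $h'=\#(\mathrm{Cl}^0 X'/\mathrm{Cl}^0 X)$ are finite, and $$h' = 2(q+1)-h .$$ -/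

import Mathlib

namespace FunctionFieldDivisor

universe u v u' v'

/-- A place of the function field `F` over the constant field `K`: a discrete valuation ring of `F`
containing `K`, with field of fractions `F`. For the function field of a smooth projective curve
these are the local rings at the closed points, i.e. the places are the prime divisors. -/
structure Place (K : Type u) (F : Type v) [Field K] [Field F] [Algebra K F] where
  ring : ValuationSubring F
  algebraMap_mem : ∀ c : K, algebraMap K F c ∈ ring
  isDVR : IsDiscreteValuationRing ring

namespace Place

section
variable {K : Type u} {F : Type v} [Field K] [Field F] [Algebra K F]

instance (P : Place K F) : IsDiscreteValuationRing P.ring := P.isDVR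

noncomputable instance (P : Place K F) : Algebra K P.ring :=
  ((algebraMap K F).codRestrict P.ring P.algebraMap_mem).toAlgebra

/-- The degree of a place: the degree over `K` of its residue field. -/
noncomputable def degree (P : Place K F) : ℕ :=
  Module.finrank K (IsLocalRing.ResidueField P.ring)

/-- The normalized (multiplicative) discrete valuation of a place. -/
noncomputable def val (P : Place K F) : Valuation F (WithZero (Multiplicative ℤ)) :=
  (IsDiscreteValuationRing.maximalIdeal P.ring).valuation F

/-- The order of vanishing at a place, normalized to take the value `1` at a uniformizer
(with the irrelevant value `0` at the zero function). -/
noncomputable def ord (P : Place K F) (f : F) : ℤ := -WithZero.log (P.val f)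

theorem ord_mul (P : Place K F) {f g : F} (hf : f ≠ 0) (hg : g ≠ 0) :
    P.ord (f * g) = P.ord f + P.ord g := by
  have h1 : P.val f ≠ 0 := (Valuation.ne_zero_iff _).2 hf
  have h2 : P.val g ≠ 0 := (Valuation.ne_zero_iff _).2 hg
  rw [ord, map_mul, WithZero.log_mul h1 h2]; simp [ord]; ring

theorem ord_one (P : Place K F) : P.ord 1 = 0 := by simp [ord]

theorem ord_inv (P : Place K F) (f : F) : P.ord f⁻¹ = -P.ord f := by
  simp [ord]

theorem mem_ring_iff (P : Place K F) {f : F} (hf : f ≠ 0) : f ∈ P.ring ↔ 0 ≤ P.ord f := by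
  have h1 : P.val f ≠ 0 := (Valuation.ne_zero_iff _).2 hf
  have : f ∈ P.ring ↔ P.val f ≤ 1 := by
    constructor
    · intro h
      exact (IsDiscreteValuationRing.maximalIdeal P.ring).valuation_le_one (⟨f, h⟩ : P.ring)
    · intro h
      obtain ⟨a, rfl⟩ := IsDiscreteValuationRing.exists_lift_of_le_one h
      exact a.2
  rw [this, ord, ← WithZero.log_le_log h1 one_ne_zero, WithZero.log_one]
  omega

theorem ord_zpow (P : Place K F) (f : F) (n : ℤ) : P.ord (f ^ n) = n * P.ord f := by
  simp [ord, WithZero.log_zpow]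

theorem exists_ord_eq_one (P : Place K F) : ∃ t : F, t ≠ 0 ∧ P.ord t = 1 := by
  obtain ⟨t, ht⟩ := (IsDiscreteValuationRing.maximalIdeal P.ring).valuation_exists_uniformizer F
  have h1 : P.ord t = 1 := by
    unfold ord val
    rw [ht]; simp
  refine ⟨t, ?_, h1⟩
  rintro rfl
  simp [ord] at h1

theorem isUnit_iff (P : Place K F) (x : P.ring) : IsUnit x ↔ (x : F) ≠ 0 ∧ P.ord x = 0 := by
  constructor
  · intro hx
    obtain ⟨y, hy⟩ := hx.exists_right_inv
    have hy' : (x : F) * y = 1 := congrArg Subtype.val hy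
    have hx0 : (x : F) ≠ 0 := left_ne_zero_of_mul_eq_one hy'
    have hy0 : (y : F) ≠ 0 := right_ne_zero_of_mul_eq_one hy'
    have h1 := (P.mem_ring_iff hx0).1 x.2
    have h2 := (P.mem_ring_iff hy0).1 y.2
    have h3 := P.ord_mul hx0 hy0
    rw [hy', ord_one] at h3
    exact ⟨hx0, by omega⟩
  · rintro ⟨hx0, hx⟩
    refine IsUnit.of_mul_eq_one ⟨(x : F)⁻¹, (P.mem_ring_iff (inv_ne_zero hx0)).2 ?_⟩ ?_
    · rw [ord_inv, hx]; simp
    · exact Subtype.ext (mul_inv_cancel₀ hx0)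

theorem ext_ring {P Q : Place K F} (h : P.ring = Q.ring) : P = Q := by
  cases P; cases Q; cases h; rfl

end

section
variable {K : Type u} {F : Type v} {K' : Type u'} {F' : Type v'} [Field K] [Field F] [Field K']
  [Field F'] [Algebra K F] [Algebra K' F'] [Algebra K K'] [Algebra F F'] [Algebra K F']
  [IsScalarTower K K' F'] [IsScalarTower K F F']

theorem exists_ord_pos [Algebra.IsAlgebraic F F'] (P' : Place K' F') :
    ∃ x : F, x ≠ 0 ∧ 0 < P'.ord (algebraMap F F' x) := by
  by_contra! hcon
  have h0 : ∀ x : F, algebraMap F F' x ∈ P'.ring := by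
    intro x
    by_cases hx : x = 0
    · simp [hx, P'.ring.zero_mem]
    · rw [P'.mem_ring_iff (by simpa using hx)]
      have := hcon x⁻¹ (inv_ne_zero hx)
      rw [map_inv₀, ord_inv] at this
      omega
  obtain ⟨t, ht0, ht⟩ := P'.exists_ord_eq_one
  have hint : t⁻¹ ∈ P'.ring := by
    have h1 : IsIntegral F t⁻¹ := Algebra.IsIntegral.isIntegral _
    obtain ⟨p, hp, hp'⟩ := h1
    have h2 : IsIntegral P'.ring t⁻¹ := by
      refine ⟨p.map ((algebraMap F F').codRestrict P'.ring h0), hp.map _, ?_⟩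
      rw [Polynomial.eval₂_map]
      exact hp'
    obtain ⟨y, hy⟩ := IsIntegrallyClosed.isIntegral_iff.1 h2
    rw [← hy]
    exact y.2
  rw [P'.mem_ring_iff (inv_ne_zero ht0), ord_inv] at hint
  omega

variable (K F) in
/-- The place of `F` lying below a place of an algebraic extension of `F`. -/
noncomputable def restrict [Algebra.IsAlgebraic F F'] (P' : Place K' F') : Place K F where
  ring := P'.ring.comap (algebraMap F F')
  algebraMap_mem c := by
    rw [ValuationSubring.mem_comap, ← IsScalarTower.algebraMap_apply K F F',
      IsScalarTower.algebraMap_apply K K' F']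
    exact P'.algebraMap_mem _
  isDVR := by
    classical
    have hmem : ∀ x : F, x ≠ 0 →
        (x ∈ P'.ring.comap (algebraMap F F') ↔ 0 ≤ P'.ord (algebraMap F F' x)) := fun x hx => by
      rw [ValuationSubring.mem_comap, P'.mem_ring_iff (by simpa using hx)]
    have hex : ∃ n : ℕ, 0 < n ∧ ∃ x : F, x ≠ 0 ∧ P'.ord (algebraMap F F' x) = n := by
      obtain ⟨x, hx, hx'⟩ := P'.exists_ord_pos (F := F)
      exact ⟨(P'.ord (algebraMap F F' x)).toNat, by omega, x, hx, by omega⟩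
    obtain ⟨hn, t, ht0, ht⟩ := Nat.find_spec hex
    set n := Nat.find hex with hndef
    have hdvd : ∀ x : F, x ≠ 0 → ∃ k : ℤ, P'.ord (algebraMap F F' x) = k * n := by
      intro x hx
      refine ⟨P'.ord (algebraMap F F' x) / n, ?_⟩
      set a := P'.ord (algebraMap F F' x) with ha
      have h1 : P'.ord (algebraMap F F' (x * t ^ (-(a / n)))) = a % n := by
        rw [map_mul, ord_mul _ (by simpa using hx)
          ((map_ne_zero _).2 (zpow_ne_zero _ ht0)), map_zpow₀, ord_zpow, ht, ← ha, Int.emod_def]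
        ring
      have h2 : a % n = 0 := by
        by_contra hne
        have h3 := Int.emod_nonneg a (b := n) (by omega)
        have h4 := Int.emod_lt_of_pos a (b := n) (by omega)
        refine Nat.find_min hex (m := (a % n).toNat) (by omega) ⟨by omega,
          x * t ^ (-(a / n)), mul_ne_zero hx (zpow_ne_zero _ ht0), ?_⟩
        rw [h1]; omega
      have := Int.mul_ediv_add_emod a n
      linarith [mul_comm (n : ℤ) (a / n)]
    have hunit : ∀ x : P'.ring.comap (algebraMap F F'),
        IsUnit x ↔ (x : F) ≠ 0 ∧ P'.ord (algebraMap F F' x) = 0 := by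
      intro x
      constructor
      · intro hx
        obtain ⟨y, hy⟩ := hx.exists_right_inv
        have hy' : (x : F) * y = 1 := congrArg Subtype.val hy
        have hx0 : (x : F) ≠ 0 := left_ne_zero_of_mul_eq_one hy'
        have hy0 : (y : F) ≠ 0 := right_ne_zero_of_mul_eq_one hy'
        refine ⟨hx0, ?_⟩
        have h1 := (hmem _ hx0).1 x.2
        have h2 := (hmem _ hy0).1 y.2
        have h3 := P'.ord_mul (f := algebraMap F F' x) (g := algebraMap F F' y)
          (by simpa using hx0) (by simpa using hy0)
        rw [← map_mul, hy', map_one, ord_one] at h3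
        omega
      · rintro ⟨hx0, hx⟩
        refine IsUnit.of_mul_eq_one ⟨(x : F)⁻¹, (hmem _ (inv_ne_zero hx0)).2 ?_⟩ ?_
        · rw [map_inv₀, ord_inv, hx]; simp
        · exact Subtype.ext (mul_inv_cancel₀ hx0)
    have htmem : t ∈ P'.ring.comap (algebraMap F F') := (hmem t ht0).2 (by omega)
    refine IsDiscreteValuationRing.ofHasUnitMulPowIrreducibleFactorization
      ⟨⟨t, htmem⟩, ⟨?_, ?_⟩, ?_⟩
    · rw [hunit]
      rintro ⟨-, h⟩
      change P'.ord (algebraMap F F' t) = 0 at h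
      omega
    · intro a b hab
      have hab' : t = (a : F) * b := congrArg Subtype.val hab
      have ha0 : (a : F) ≠ 0 := left_ne_zero_of_mul (hab' ▸ ht0)
      have hb0 : (b : F) ≠ 0 := right_ne_zero_of_mul (hab' ▸ ht0)
      have h1 := (hmem _ ha0).1 a.2
      have h2 := (hmem _ hb0).1 b.2
      have h3 := P'.ord_mul (f := algebraMap F F' a) (g := algebraMap F F' b)
          (by simpa using ha0) (by simpa using hb0)
      rw [← map_mul, ← hab', ht] at h3
      by_contra! hcon
      have h4 : P'.ord (algebraMap F F' a) ≠ 0 := fun h => hcon.1 ((hunit a).2 ⟨ha0, h⟩)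
      have h5 : P'.ord (algebraMap F F' b) ≠ 0 := fun h => hcon.2 ((hunit b).2 ⟨hb0, h⟩)
      exact Nat.find_min hex (m := (P'.ord (algebraMap F F' a)).toNat) (by omega)
        ⟨by omega, a, ha0, by omega⟩
    · intro x hx
      have hx0 : (x : F) ≠ 0 := fun h => hx (Subtype.ext h)
      obtain ⟨k, hk⟩ := hdvd x hx0
      have hk0 : 0 ≤ k := by
        have := (hmem _ hx0).1 x.2
        rw [hk] at this
        exact nonneg_of_mul_nonneg_left this (by omega)
      obtain ⟨k, rfl⟩ := Int.eq_ofNat_of_zero_le hk0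
      have hord : P'.ord (algebraMap F F' ((x : F) * t ^ (-(k : ℤ)))) = 0 := by
        rw [map_mul, ord_mul _ (by simpa using hx0) ((map_ne_zero _).2 (zpow_ne_zero _ ht0)),
          map_zpow₀, ord_zpow, ht, hk]
        ring
      have hne : (x : F) * t ^ (-(k : ℤ)) ≠ 0 := mul_ne_zero hx0 (zpow_ne_zero _ ht0)
      refine ⟨k, ((hunit ⟨_, (hmem _ hne).2 hord.ge⟩).2 ⟨hne, hord⟩).unit, Subtype.ext ?_⟩
      change t ^ k * ((x : F) * t ^ (-(k : ℤ))) = x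
      rw [zpow_neg, zpow_natCast]
      field_simp

theorem mem_restrict_ring [Algebra.IsAlgebraic F F'] (P' : Place K' F') (x : F) :
    x ∈ (P'.restrict K F).ring ↔ algebraMap F F' x ∈ P'.ring := by
  rw [restrict, ValuationSubring.mem_comap]

/-- A chosen function with `P.ord = 1`. -/
noncomputable def uniformizer (P : Place K F) : F := P.exists_ord_eq_one.choose

variable (K F) in
/-- The ramification index of a place over the place below it. -/
noncomputable def ramificationIdx [Algebra.IsAlgebraic F F'] (P' : Place K' F') : ℤ :=
  P'.ord (algebraMap F F' (P'.restrict K F).uniformizer)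

theorem ord_algebraMap [Algebra.IsAlgebraic F F'] (P' : Place K' F') {f : F} (hf : f ≠ 0) :
    P'.ord (algebraMap F F' f) = P'.ramificationIdx K F * (P'.restrict K F).ord f := by
  set P := P'.restrict K F with hP
  have ht0 : P.uniformizer ≠ 0 := P.exists_ord_eq_one.choose_spec.1
  have ht : P.ord P.uniformizer = 1 := P.exists_ord_eq_one.choose_spec.2
  set g := f * P.uniformizer ^ (-P.ord f) with hg
  have hg0 : g ≠ 0 := mul_ne_zero hf (zpow_ne_zero _ ht0)
  have hgord : P.ord g = 0 := by
    rw [hg, ord_mul _ hf (zpow_ne_zero _ ht0), ord_zpow, ht]; ring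
  have h1 : g ∈ P.ring := (P.mem_ring_iff hg0).2 hgord.ge
  have h2 : g⁻¹ ∈ P.ring := (P.mem_ring_iff (inv_ne_zero hg0)).2 (by rw [ord_inv, hgord]; simp)
  rw [hP, mem_restrict_ring, mem_ring_iff _ (by simpa using hg0)] at h1
  rw [hP, mem_restrict_ring, mem_ring_iff _ (by simpa using hg0), map_inv₀, ord_inv] at h2
  have h3 : P'.ord (algebraMap F F' g) = 0 := by omega
  rw [hg, map_mul, ord_mul _ (by simpa using hf) ((map_ne_zero _).2 (zpow_ne_zero _ ht0)),
    map_zpow₀, ord_zpow] at h3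
  rw [ramificationIdx]
  linarith [mul_comm (P.ord f) (P'.ord (algebraMap F F' P.uniformizer))]

theorem ramificationIdx_pos [Algebra.IsAlgebraic F F'] (P' : Place K' F') :
    0 < P'.ramificationIdx K F := by
  have ht0 : (P'.restrict K F).uniformizer ≠ 0 := (P'.restrict K F).exists_ord_eq_one.choose_spec.1
  have ht : (P'.restrict K F).ord (P'.restrict K F).uniformizer = 1 :=
    (P'.restrict K F).exists_ord_eq_one.choose_spec.2
  have h1 : 0 ≤ P'.ramificationIdx K F := by
    rw [ramificationIdx, ← P'.mem_ring_iff ((map_ne_zero _).2 ht0), ← mem_restrict_ring (K := K),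
      mem_ring_iff _ ht0, ht]
    exact zero_le_one
  have h2 : P'.ramificationIdx K F ≠ 0 := by
    intro h
    obtain ⟨x, hx, hx'⟩ := P'.exists_ord_pos (F := F)
    rw [P'.ord_algebraMap (K := K) hx, h] at hx'
    simp at hx'
  omega

/-- There are only finitely many places above a given place. -/
theorem finite_restrict_eq [FiniteDimensional F F'] [Algebra.IsSeparable F F'] (P : Place K F) :
    {P' : Place K' F' | P'.restrict K F = P}.Finite := by
  classical
  let B := integralClosure P.ring F'
  have : IsDedekindDomain B := integralClosure.isDedekindDomain P.ring F F'
  have : Module.Finite P.ring B := IsIntegralClosure.finite P.ring F F' B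
  have : IsFractionRing B F' := integralClosure.isFractionRing_of_finite_extension F F'
  have hB : ∀ P' : Place K' F', P'.restrict K F = P → ∀ b : B, (b : F') ∈ P'.ring := by
    intro P' hP' b
    obtain ⟨p, hp, hp'⟩ := b.2
    have h0 : ∀ x : P.ring, algebraMap P.ring F' x ∈ P'.ring := by
      intro x
      have hx : (x : F) ∈ (P'.restrict K F).ring := hP'.symm ▸ x.2
      exact (mem_restrict_ring P' _).1 hx
    have h2 : IsIntegral P'.ring (b : F') := by
      refine ⟨p.map ((algebraMap P.ring F').codRestrict P'.ring h0), hp.map _, ?_⟩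
      rw [Polynomial.eval₂_map]
      exact hp'
    obtain ⟨y, hy⟩ := IsIntegrallyClosed.isIntegral_iff.1 h2
    rw [← hy]
    exact y.2
  let c : ∀ P' : Place K' F', P'.restrict K F = P → B →+* P'.ring := fun P' h =>
    (algebraMap B F').codRestrict P'.ring (hB P' h)
  let I : Place K' F' → Ideal B := fun P' =>
    if h : P'.restrict K F = P then (IsLocalRing.maximalIdeal P'.ring).comap (c P' h) else ⊤
  have hI : ∀ P' : Place K' F', P'.restrict K F = P → ∀ b : B,
      b ∈ I P' ↔ (b : F') = 0 ∨ 0 < P'.ord b := by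
    intro P' h b
    have hb := hB P' h b
    simp only [I, dif_pos h, Ideal.mem_comap, IsLocalRing.mem_maximalIdeal, mem_nonunits_iff]
    by_cases hb0 : (b : F') = 0
    · have : c P' h b = 0 := Subtype.ext hb0
      simp [this, hb0]
    · rw [P'.isUnit_iff]
      have h1 := (P'.mem_ring_iff hb0).1 hb
      change ¬ ((b : F') ≠ 0 ∧ P'.ord b = 0) ↔ _
      constructor
      · intro h2
        right
        have : P'.ord b ≠ 0 := fun h3 => h2 ⟨hb0, h3⟩
        omega
      · rintro (h2 | h2) ⟨-, h3⟩
        · exact hb0 h2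
        · omega
  have hprime : ∀ P' : Place K' F', P'.restrict K F = P → (I P').IsPrime := by
    intro P' h
    simp only [I, dif_pos h]
    infer_instance
  have hover : ∀ P' : Place K' F', P'.restrict K F = P →
      I P' ∈ (IsLocalRing.maximalIdeal P.ring).primesOver B := by
    intro P' h
    refine ⟨hprime P' h, ⟨?_⟩⟩
    ext x
    rw [Ideal.mem_comap, hI P' h, IsLocalRing.mem_maximalIdeal, mem_nonunits_iff]
    change _ ↔ algebraMap F F' x = 0 ∨ 0 < P'.ord (algebraMap F F' x)
    rw [P.isUnit_iff]
    by_cases hx0 : (x : F) = 0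
    · simp [hx0]
    · have hx := (P.mem_ring_iff hx0).1 x.2
      have hpos : 0 < P'.ramificationIdx K F := P'.ramificationIdx_pos
      rw [P'.ord_algebraMap (K := K) hx0, h, mul_pos_iff_of_pos_left hpos]
      simp only [map_eq_zero, hx0, false_or, ne_eq, not_false_eq_true, true_and]
      omega
  have hle : ∀ P₁ P₂ : Place K' F', P₁.restrict K F = P → P₂.restrict K F = P → I P₁ = I P₂ →
      P₁.ring ≤ P₂.ring := by
    intro P₁ P₂ h₁ h₂ h x hx
    have hbot : I P₁ ≠ ⊥ := by
      intro hb
      have h3 := (hover P₁ h₁).2.over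
      rw [hb] at h3
      have h4 : IsLocalRing.maximalIdeal P.ring = ⊥ := by
        rw [h3]
        exact Ideal.comap_bot_of_injective _ fun a b hab =>
          Subtype.ext ((algebraMap F F').injective (congrArg Subtype.val hab))
      exact IsDiscreteValuationRing.not_a_field P.ring h4
    let v : IsDedekindDomain.HeightOneSpectrum B := ⟨I P₁, hprime P₁ h₁, hbot⟩
    by_cases hx0 : x = 0
    · rw [hx0]; exact P₂.ring.zero_mem
    have hcompl : ∀ d : B, d ∉ I P₁ → (d : F') ≠ 0 ∧ P₁.ord d = 0 ∧ P₂.ord d = 0 := by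
      intro d hd
      have hd' := hd
      rw [h, hI P₂ h₂] at hd'
      rw [hI P₁ h₁] at hd
      push Not at hd hd'
      have h5 := (P₁.mem_ring_iff hd.1).1 (hB P₁ h₁ d)
      have h6 := (P₂.mem_ring_iff hd.1).1 (hB P₂ h₂ d)
      exact ⟨hd.1, by omega, by omega⟩
    obtain ⟨n, d, hnd⟩ := v.exists_primeCompl_mul_eq_or_mul_eq x
    obtain ⟨hd0, hd1, hd2⟩ := hcompl d d.2
    rw [P₁.mem_ring_iff hx0] at hx
    rw [P₂.mem_ring_iff hx0]
    rcases hnd with hnd | hnd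
    · change x * (d : B) = (n : F') at hnd
      have hn0 : (n : F') ≠ 0 := hnd ▸ mul_ne_zero hx0 hd0
      have h7 := (P₂.mem_ring_iff hn0).1 (hB P₂ h₂ n)
      rw [← hnd, ord_mul _ hx0 hd0] at h7
      omega
    · change x * n = ((d : B) : F') at hnd
      have hn0 : (n : F') ≠ 0 := right_ne_zero_of_mul (hnd ▸ hd0 : x * (n : F') ≠ 0)
      have h8 : n ∉ I P₁ := by
        rw [hI P₁ h₁]
        rintro (h9 | h9)
        · exact hn0 h9
        · rw [← hnd, ord_mul _ hx0 hn0] at hd1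
          omega
      have h10 := (hcompl n h8).2.2
      rw [← hnd, ord_mul _ hx0 hn0] at hd2
      omega
  refine Set.Finite.of_injOn (f := I) (fun P' hP' => hover P' hP') ?_
    (Algebra.QuasiFinite.finite_primesOver (IsLocalRing.maximalIdeal P.ring))
  intro P₁ h₁ P₂ h₂ h
  exact ext_ring (le_antisymm (hle P₁ P₂ h₁ h₂ h) (hle P₂ P₁ h₂ h₁ h.symm))

end
end Place

section
variable (K : Type u) (F : Type v) [Field K] [Field F] [Algebra K F]

/-- Divisors: finite formal integral combinations of places. -/
abbrev Divisor : Type v := Place K F →₀ ℤ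

variable {K F} in
/-- The degree of a divisor, the sum of `D P * deg P` over all places `P`. -/
noncomputable def Divisor.degree : Divisor K F →+ ℤ :=
  Finsupp.liftAddHom fun P => AddMonoidHom.mulRight (P.degree : ℤ)

/-- The group of principal divisors, i.e. divisors of nonzero functions. -/
def principalDivisors : AddSubgroup (Divisor K F) where
  carrier := {D | ∃ f : F, f ≠ 0 ∧ ∀ P : Place K F, D P = P.ord f}
  zero_mem' := ⟨1, one_ne_zero, fun P => by simp [P.ord_one]⟩
  add_mem' := by
    rintro D E ⟨f, hf, hD⟩ ⟨g, hg, hE⟩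
    exact ⟨f * g, mul_ne_zero hf hg, fun P => by simp [P.ord_mul hf hg, hD, hE]⟩
  neg_mem' := by
    rintro D ⟨f, hf, hD⟩
    exact ⟨f⁻¹, inv_ne_zero hf, fun P => by simp [P.ord_inv, hD]⟩

/-- The divisor class group: divisors modulo principal divisors. -/
abbrev DivisorClassGroup : Type v := Divisor K F ⧸ principalDivisors K F

/-- The group of divisor classes of degree zero. -/
noncomputable def classGroupZero : AddSubgroup (DivisorClassGroup K F) :=
  (Divisor.degree (K := K) (F := F)).ker.map (QuotientAddGroup.mk' (principalDivisors K F))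

end

section
variable (K : Type u) (F : Type v) (K' : Type u') (F' : Type v') [Field K] [Field F] [Field K']
  [Field F'] [Algebra K F] [Algebra K' F'] [Algebra K K'] [Algebra F F'] [Algebra K F']
  [IsScalarTower K F F'] [IsScalarTower K K' F'] [FiniteDimensional F F'] [Algebra.IsSeparable F F']

/-- The pull-back (conorm) of divisors along a finite separable extension of function fields: the
coefficient at a place upstairs is the ramification index times the coefficient at the place below. -/
noncomputable def pullback : Divisor K F →+ Divisor K' F' where
  toFun D := Finsupp.ofSupportFinite
    (fun P' => P'.ramificationIdx K F * D (P'.restrict K F)) <| by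
      refine (D.support.finite_toSet.biUnion fun P _ =>
        Place.finite_restrict_eq (K' := K') (F' := F') P).subset fun P' hP' => ?_
      rw [Set.mem_iUnion₂]
      refine ⟨P'.restrict K F, ?_, rfl⟩
      rw [Finset.mem_coe, Finsupp.mem_support_iff]
      exact right_ne_zero_of_mul hP'
  map_zero' := by ext P'; simp [Finsupp.ofSupportFinite]
  map_add' D E := by ext P'; simp [Finsupp.ofSupportFinite, mul_add]

theorem pullback_apply (D : Divisor K F) (P' : Place K' F') :
    pullback K F K' F' D P' = P'.ramificationIdx K F * D (P'.restrict K F) := rfl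

/-- The homomorphism of divisor class groups induced by the pull-back of divisors. -/
noncomputable def classGroupPullback : DivisorClassGroup K F →+ DivisorClassGroup K' F' :=
  QuotientAddGroup.map _ _ (pullback K F K' F') <| by
    rintro D ⟨f, hf, hD⟩
    exact ⟨algebraMap F F' f, by simpa using hf, fun P' => by
      rw [pullback_apply, hD, ← P'.ord_algebraMap hf]⟩

end
end FunctionFieldDivisor

namespace WeierstrassCurve
universe u u'
variable {K : Type u} (K' : Type u') [Field K] [Field K'] [Algebra K K'] (W : WeierstrassCurve K)
open WeierstrassCurve.Affine

/-- The function field of a Weierstrass curve is contained in the function field of its base change. -/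
noncomputable instance functionFieldAlgebra :
    Algebra W.toAffine.FunctionField (W.map (algebraMap K K')).toAffine.FunctionField :=
  (IsFractionRing.map (CoordinateRing.map_injective (W' := W.toAffine) (f := algebraMap K K')
    (algebraMap K K').injective)).toAlgebra

theorem algebraMap_functionField (a : W.toAffine.CoordinateRing) :
    algebraMap W.toAffine.FunctionField (W.map (algebraMap K K')).toAffine.FunctionField
      (algebraMap W.toAffine.CoordinateRing _ a) =
    algebraMap (W.map (algebraMap K K')).toAffine.CoordinateRing _
      (CoordinateRing.map W.toAffine (algebraMap K K') a) :=
  by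
  change IsFractionRing.map _ _ = _
  rw [IsFractionRing.map, IsLocalization.map_eq]

theorem coordinateRing_map_algebraMap (c : K) :
    CoordinateRing.map W.toAffine (algebraMap K K') (algebraMap K W.toAffine.CoordinateRing c) =
      algebraMap K' (W.map (algebraMap K K')).toAffine.CoordinateRing (algebraMap K K' c) := by
  change CoordinateRing.map W.toAffine (algebraMap K K')
    (CoordinateRing.mk W.toAffine (Polynomial.C (Polynomial.C c))) = 
    CoordinateRing.mk _ (Polynomial.C (Polynomial.C (algebraMap K K' c)))
  rw [CoordinateRing.map_mk]
  simp

instance isScalarTower_functionField : IsScalarTower K W.toAffine.FunctionField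
    (W.map (algebraMap K K')).toAffine.FunctionField := by
  refine IsScalarTower.of_algebraMap_eq fun c => ?_
  rw [IsScalarTower.algebraMap_apply K W.toAffine.CoordinateRing W.toAffine.FunctionField,
    algebraMap_functionField, coordinateRing_map_algebraMap,
    ← IsScalarTower.algebraMap_apply K' (W.map (algebraMap K K')).toAffine.CoordinateRing,
    ← IsScalarTower.algebraMap_apply]

theorem adjoin_constants_eq_top (S : Set K') (hS : Submodule.span K S = ⊤) :
    IntermediateField.adjoin W.toAffine.FunctionField
      (Set.image (algebraMap K' (W.map (algebraMap K K')).toAffine.FunctionField) S) = ⊤ := by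
  let W' := W.map (algebraMap K K')
  let F' := W'.toAffine.FunctionField
  obtain ⟨E, hE⟩ : ∃ E, E = IntermediateField.adjoin W.toAffine.FunctionField
    (Set.image (algebraMap K' (W.map (algebraMap K K')).toAffine.FunctionField) S) := ⟨_, rfl⟩
  rw [← hE]
  have hK : ∀ c : K', algebraMap K' F' c ∈ E := by
    intro c
    have hc : c ∈ Submodule.span K S := hS ▸ Submodule.mem_top
    induction hc using Submodule.span_induction with
    | mem x hx => exact hE ▸ IntermediateField.subset_adjoin _ _ ⟨x, hx, rfl⟩
    | zero => rw [map_zero]; exact E.zero_mem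
    | add x y _ _ hx hy => rw [map_add]; exact E.add_mem hx hy
    | smul a x _ hx =>
      rw [Algebra.smul_def, map_mul, ← IsScalarTower.algebraMap_apply K K' F',
        IsScalarTower.algebraMap_apply K W.toAffine.FunctionField F']
      exact E.mul_mem (E.algebraMap_mem _) hx
  have hX : algebraMap W'.toAffine.CoordinateRing F'
      (CoordinateRing.mk W'.toAffine (Polynomial.C Polynomial.X)) ∈ E := by
    have h := algebraMap_functionField K' W (CoordinateRing.mk W.toAffine (Polynomial.C Polynomial.X))
    rw [CoordinateRing.map_mk] at h
    simp only [Polynomial.map_C, Polynomial.coe_mapRingHom, Polynomial.map_X] at h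
    rw [← h]
    exact E.algebraMap_mem _
  have hY : algebraMap W'.toAffine.CoordinateRing F'
      (CoordinateRing.mk W'.toAffine Polynomial.X) ∈ E := by
    have h := algebraMap_functionField K' W (CoordinateRing.mk W.toAffine Polynomial.X)
    rw [CoordinateRing.map_mk, Polynomial.map_X] at h
    rw [← h]
    exact E.algebraMap_mem _
  have hA : ∀ a : W'.toAffine.CoordinateRing, algebraMap _ F' a ∈ E := by
    intro a
    obtain ⟨p, rfl⟩ := AdjoinRoot.mk_surjective a
    change algebraMap _ F' (CoordinateRing.mk W'.toAffine p) ∈ E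
    induction p using Polynomial.induction_on' with
    | add p q hp hq => rw [map_add, map_add]; exact E.add_mem hp hq
    | monomial n c =>
      rw [← Polynomial.C_mul_X_pow_eq_monomial, map_mul, map_mul, map_pow, map_pow]
      refine E.mul_mem ?_ (E.pow_mem hY n)
      induction c using Polynomial.induction_on' with
      | add p q hp hq => rw [Polynomial.C_add, map_add, map_add]; exact E.add_mem hp hq
      | monomial m c =>
        rw [← Polynomial.C_mul_X_pow_eq_monomial, Polynomial.C_mul, Polynomial.C_pow,
          map_mul, map_mul, map_pow, map_pow]
        refine E.mul_mem ?_ (E.pow_mem hX m)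
        have h := hK c
        rw [IsScalarTower.algebraMap_apply K' W'.toAffine.CoordinateRing F'] at h
        exact h
  rw [eq_top_iff]
  rintro z -
  obtain ⟨a, b, -, rfl⟩ := IsFractionRing.div_surjective W'.toAffine.CoordinateRing z
  exact E.div_mem (hA a) (hA b)

instance finiteDimensional_functionField [FiniteDimensional K K'] :
    FiniteDimensional W.toAffine.FunctionField
      (W.map (algebraMap K K')).toAffine.FunctionField := by
  have h := adjoin_constants_eq_top K' W _ (Module.finBasis K K').span_eq
  have h2 := IntermediateField.finiteDimensional_adjoin (K := W.toAffine.FunctionField)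
    (S := Set.image (algebraMap K' (W.map (algebraMap K K')).toAffine.FunctionField)
      (Set.range (Module.finBasis K K'))) (by
      rintro _ ⟨x, -, rfl⟩
      have hx : _root_.IsIntegral K x := Algebra.IsIntegral.isIntegral x
      exact (hx.map (IsScalarTower.toAlgHom K K' _)).tower_top)
  rw [h] at h2
  exact Module.Finite.equiv IntermediateField.topEquiv.toLinearEquiv

instance isSeparable_functionField [Algebra.IsSeparable K K'] :
    Algebra.IsSeparable W.toAffine.FunctionField
      (W.map (algebraMap K K')).toAffine.FunctionField := by
  have h := adjoin_constants_eq_top K' W Set.univ (Submodule.span_univ)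
  have h2 := (IntermediateField.isSeparable_adjoin_iff_isSeparable W.toAffine.FunctionField
    (W.map (algebraMap K K')).toAffine.FunctionField
    (S := Set.image (algebraMap K' (W.map (algebraMap K K')).toAffine.FunctionField) Set.univ)).2 (by
      rintro _ ⟨x, -, rfl⟩
      have hx : IsSeparable K x := Algebra.IsSeparable.isSeparable K x
      exact (IsSeparable.map (IsScalarTower.toAlgHom K K' _) (algebraMap K' _).injective hx).tower_top _)
  rw [h] at h2
  exact Algebra.IsSeparable.of_algHom _ _ (IntermediateField.topEquiv.symm.toAlgHom)

/-- The divisor class group of the (projective) curve `W`. -/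
noncomputable abbrev Cl : Type u :=
  FunctionFieldDivisor.DivisorClassGroup K W.toAffine.FunctionField

/-- The divisor class group of degree zero of the curve `W`. -/
noncomputable abbrev ClZero : AddSubgroup (Cl W) :=
  FunctionFieldDivisor.classGroupZero K W.toAffine.FunctionField

/-- The pull-back of divisor classes of `W` to the base change of `W` along a separable extension of
the constant field. -/
noncomputable def clBaseChange [FiniteDimensional K K'] [Algebra.IsSeparable K K'] :
    Cl W →+ Cl (W.map (algebraMap K K')) :=
  FunctionFieldDivisor.classGroupPullback K W.toAffine.FunctionField K'
    (W.map (algebraMap K K')).toAffine.FunctionField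

end WeierstrassCurve

open Polynomial

/-! Write `K`, `K'` for the two fields, `q` for the order of `K` and `O` for the point at infinity.
Sending a rational point `Q` to the class of `[Q] - [O]` identifies the rational points with the
divisor classes of degree zero (`equivClassGroupZero`). Under this identification pull-back becomes
the inclusion of the `K`-points in the `K'`-points (`clBaseChange_divisorClass`), because a rational
point has exactly one place above it, and that place is unramified. Hence pull-back is injective,
`h` is the number of `K`-points, and `h * h'` is the number of `K'`-points.

The identification rests on three facts. The coordinate ring is a Dedekind domain, because the curve
is nonsingular (`exists_locally_principal`). The places are its maximal ideals together with
infinity (`eq_infty_or_exists_eq_ofPrime`). Every ideal class contains the ideal of a point or the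
unit ideal, by a dimension count that replaces Riemann-Roch (`toClass_surjective`).

For the count, let `σ` be the `q`-Frobenius of `K'`, an involution with fixed field `K`. Let `t` be
the number of `K'`-points with `σ P = -P`; these correspond to the points of the quadratic twist.
Over each abscissa in `K` the two conditions `σ P = P` and `σ P = -P` together have two solutions,
and `O` satisfies both, so `h + t = 2 (q + 1)` (`card_fixed_add_card_neg`). The homomorphism `1 + σ`
on the `K'`-points has kernel `{σ P = -P}` and image `{σ P = P}`, so `h * t` is the number of
`K'`-points (`card_fixed_mul_card_neg`). Therefore `h' = t`. The hard point is that every rational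
point has the form `R + σ R` (`exists_add_map_eq`); this follows from counting the lines through a
rational point. -/

/-! ### A local criterion for Dedekind domains -/

theorem isDiscreteValuationRing_localization_of_locally_principal {R : Type*} [CommRing R]
    [IsDomain R] [IsNoetherianRing R] (P : Ideal R) [P.IsPrime] (hP : P ≠ ⊥)
    (h : ∃ t ∈ P, ∀ a ∈ P, ∃ s, s ∉ P ∧ t ∣ s * a) :
    IsDiscreteValuationRing (Localization.AtPrime P) := by
  have : IsNoetherianRing (Localization.AtPrime P) :=
    IsLocalization.isNoetherianRing P.primeCompl _ inferInstance
  have hf : ¬ IsField (Localization.AtPrime P) := by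
    rw [IsLocalRing.isField_iff_maximalIdeal_eq]
    intro hbot
    apply hP
    rw [← IsLocalization.AtPrime.under_maximalIdeal (Localization.AtPrime P) P, hbot]
    exact Ideal.comap_bot_of_injective _
      (IsLocalization.injective _ P.primeCompl_le_nonZeroDivisors)
  -- It suffices that the maximal ideal is principal; the image of `t` generates it because the
  -- multipliers `s` become units.
  refine ((IsDiscreteValuationRing.TFAE _ hf).out 4 0).1 ?_
  obtain ⟨t, ht, h⟩ := h
  refine ⟨algebraMap R _ t, ?_⟩
  rw [Ideal.submodule_span_eq]
  rw [← Localization.AtPrime.map_eq_maximalIdeal]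
  refine le_antisymm ?_ ?_
  · rw [Ideal.map_le_iff_le_comap]
    intro a ha
    obtain ⟨s, hs, d, hd⟩ := h a ha
    rw [Ideal.mem_comap, Ideal.mem_span_singleton]
    have hu : IsUnit (algebraMap R (Localization.AtPrime P) s) :=
      IsLocalization.map_units _ (⟨s, hs⟩ : P.primeCompl)
    rw [← hu.dvd_mul_left, ← map_mul, hd, map_mul]
    exact dvd_mul_right _ _
  · rw [Ideal.span_singleton_le_iff_mem]
    exact Ideal.mem_map_of_mem _ ht

theorem isDedekindDomain_of_locally_principal {R : Type*} [CommRing R] [IsDomain R]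
    [IsNoetherianRing R]
    (h : ∀ P : Ideal R, P.IsPrime → P ≠ ⊥ → ∃ t ∈ P, ∀ a ∈ P, ∃ s, s ∉ P ∧ t ∣ s * a) :
    IsDedekindDomain R := by
  have : IsDedekindDomainDvr R :=
    { is_dvr_at_nonzero_prime := fun P hP hP' =>
        isDiscreteValuationRing_localization_of_locally_principal P hP (h P hP' hP) }
  infer_instance

/-! ### The coordinate ring of an elliptic curve is Dedekind -/

namespace WeierstrassCurve.Affine.CoordinateRing

section
variable {K : Type*} [Field K] (W : WeierstrassCurve.Affine K)

/-- The inclusion of the polynomials in `X` in the coordinate ring. -/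
noncomputable abbrev ofX : K[X] →+* W.CoordinateRing := (mk W).comp C

/-- The coordinate function `Y`. -/
noncomputable abbrev coordY : W.CoordinateRing := mk W X

/-- The linear polynomial `a₁X + a₃`. -/
noncomputable abbrev linPoly : K[X] := C W.a₁ * X + C W.a₃

/-- The polynomial `X³ + a₂X² + a₄X + a₆`. -/
noncomputable abbrev cubPoly : K[X] := X ^ 3 + C W.a₂ * X ^ 2 + C W.a₄ * X + C W.a₆

theorem coordY_sq : coordY W ^ 2 = ofX W (cubPoly W) - ofX W (linPoly W) * coordY W := by
  have : mk W X ^ 2 = mk W (C (cubPoly W) - C (linPoly W) * X) :=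
    AdjoinRoot.mk_eq_mk.mpr ⟨1, by simp only [polynomial]; ring1⟩
  rw [coordY, this]; simp

theorem exists_eq_ofX_add (a : W.CoordinateRing) :
    ∃ p q : K[X], a = ofX W p + ofX W q * coordY W := by
  obtain ⟨p, q, h⟩ := exists_smul_basis_eq a
  exact ⟨p, q, by rw [← h, smul, smul]; simp⟩

theorem ofX_add_eq_smul (p q : K[X]) :
    ofX W p + ofX W q * coordY W = p • (1 : W.CoordinateRing) + q • mk W X := by
  rw [smul, smul]; simp

theorem ofX_add_eq_zero {p q : K[X]} (h : ofX W p + ofX W q * coordY W = 0) : p = 0 ∧ q = 0 :=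
  smul_basis_eq_zero ((ofX_add_eq_smul W p q).symm.trans h)

theorem ofX_eq_algebraMap : ofX W = algebraMap K[X] W.CoordinateRing := rfl

theorem ofX_C (c : K) : ofX W (C c) = algebraMap K W.CoordinateRing c := rfl

theorem ofX_injective : Function.Injective (ofX W) :=
  FaithfulSMul.algebraMap_injective K[X] W.CoordinateRing

theorem mul_conj (p q : K[X]) :
    (ofX W p + ofX W q * coordY W) * (ofX W p - ofX W q * (coordY W + ofX W (linPoly W))) =
      ofX W (p ^ 2 - p * q * linPoly W - q ^ 2 * cubPoly W) := by
  simp only [map_sub, map_mul, map_pow]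
  linear_combination (-ofX W q ^ 2) * coordY_sq W

instance : Module.Finite K[X] W.CoordinateRing := .of_basis (CoordinateRing.basis W)

instance : IsNoetherianRing W.CoordinateRing := IsNoetherianRing.of_finite K[X] _

/-- At every prime of the coordinate ring of an elliptic curve one of the partial derivatives of the
Weierstrass polynomial does not vanish. -/
theorem partial_notMem [W.IsElliptic] (P : Ideal W.CoordinateRing) [P.IsPrime] :
    ofX W (C W.a₁) * coordY W - ofX W (3 * X ^ 2 + 2 * C W.a₂ * X + C W.a₄) ∉ P ∨
      2 * coordY W + ofX W (linPoly W) ∉ P := by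
  let f : K →+* W.CoordinateRing ⧸ P := algebraMap K _
  have hf : ∀ c : K, f c = Ideal.Quotient.mk P (ofX W (C c)) := fun c => rfl
  let W' : WeierstrassCurve.Affine (W.CoordinateRing ⧸ P) := WeierstrassCurve.map W f
  have : W'.IsElliptic := inferInstanceAs (WeierstrassCurve.map W f).IsElliptic
  have h1 : W'.Equation (Ideal.Quotient.mk P (ofX W X)) (Ideal.Quotient.mk P (coordY W)) := by
    rw [equation_iff']
    have h := congrArg (Ideal.Quotient.mk P) (coordY_sq W)
    simp only [map_sub, map_mul, map_pow, map_add] at h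
    simp only [W', map_a₁, map_a₂, map_a₃, map_a₄, map_a₆, hf]
    linear_combination h
  rw [equation_iff_nonsingular, nonsingular_iff'] at h1
  refine h1.2.imp (fun h h' => h ?_) fun h h' => h ?_
  · rw [← Ideal.Quotient.eq_zero_iff_mem] at h'
    rw [← h']
    simp only [W', map_a₁, map_a₂, map_a₄, hf, map_sub, map_mul, map_pow, map_add, map_ofNat]
  · rw [← Ideal.Quotient.eq_zero_iff_mem] at h'
    rw [← h']
    simp only [W', map_a₁, map_a₃, hf, map_mul, map_add, map_ofNat]
    ring

/-- The choice of local generator depends on how `P` lies over its contraction `(g)` to `K[X]`. If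
the `Y`-derivative is not in `P`, or if every `p + qY` in `P` has `q` in `P`, then `g` works.
Otherwise `P` contains some `c + Y`; the `X`-derivative is then not in `P`, which makes the norm of
`c + Y` divisible by `g` only once, and `c + Y` works. -/
theorem exists_locally_principal [W.IsElliptic] (P : Ideal W.CoordinateRing) [P.IsPrime]
    (hP : P ≠ ⊥) : ∃ t ∈ P, ∀ a ∈ P, ∃ s, s ∉ P ∧ t ∣ s * a := by
  have hp0 : P.comap (ofX W) ≠ ⊥ := by
    obtain ⟨a, ha, ha0⟩ := Submodule.exists_mem_ne_zero_of_ne_bot hP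
    rw [ofX_eq_algebraMap]
    exact Ideal.comap_ne_bot_of_integral_mem ha0 ha (Algebra.IsIntegral.isIntegral _)
  obtain ⟨g, hg⟩ := IsPrincipalIdealRing.principal (P.comap (ofX W))
  rw [Ideal.submodule_span_eq] at hg
  have hmem : ∀ p, ofX W p ∈ P ↔ g ∣ p := fun p => by
    rw [← Ideal.mem_comap, hg, Ideal.mem_span_singleton]
  have hg0 : g ≠ 0 := by rintro rfl; exact hp0 (by simpa using hg)
  have hgp : Prime g := by
    rw [← Ideal.span_singleton_prime hg0, ← hg]; exact Ideal.comap_isPrime _ _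
  have hgP : ofX W g ∈ P := (hmem g).2 dvd_rfl
  have hdvd : ∀ {p}, g ∣ p → ofX W g ∣ ofX W p := fun h => map_dvd _ h
  by_cases hY : 2 * coordY W + ofX W (linPoly W) ∈ P
  swap
  -- An element `p + qY` of `P` and its conjugate differ by `q (2Y + a₁X + a₃)`. If the conjugate is
  -- also in `P`, then so are `q` and `p`, which are therefore divisible by `g`. If not, the
  -- conjugate serves as `s`, since the norm is divisible by `g`.
  · refine ⟨ofX W g, hgP, fun a ha => ?_⟩
    obtain ⟨p, q, rfl⟩ := exists_eq_ofX_add W a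
    by_cases hc : ofX W p - ofX W q * (coordY W + ofX W (linPoly W)) ∈ P
    · have hq : ofX W q ∈ P := by
        have h := P.sub_mem ha hc
        refine (Ideal.IsPrime.mem_or_mem ‹_› (?_ : ofX W q * (2 * coordY W + ofX W (linPoly W)) ∈ P)).resolve_right hY
        convert h using 1; ring
      have hp : ofX W p ∈ P := by
        have := P.sub_mem ha (P.mul_mem_right (coordY W) hq)
        simpa using this
      exact ⟨1, (Ideal.ne_top_iff_one P).1 Ideal.IsPrime.ne_top', by
        rw [one_mul]
        exact dvd_add (hdvd ((hmem _).1 hp)) ((hdvd ((hmem _).1 hq)).mul_right _)⟩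
    · refine ⟨_, hc, ?_⟩
      rw [mul_comm, mul_conj]
      exact hdvd ((hmem _).1 (by rw [← mul_conj]; exact P.mul_mem_right _ ha))
  by_cases hall : ∀ p q, ofX W p + ofX W q * coordY W ∈ P → ofX W q ∈ P
  · refine ⟨ofX W g, hgP, fun a ha => ?_⟩
    obtain ⟨p, q, rfl⟩ := exists_eq_ofX_add W a
    have hq := hall p q ha
    have hp : ofX W p ∈ P := by
      have := P.sub_mem ha (P.mul_mem_right (coordY W) hq)
      simpa using this
    exact ⟨1, (Ideal.ne_top_iff_one P).1 Ideal.IsPrime.ne_top', by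
      rw [one_mul]
      exact dvd_add (hdvd ((hmem _).1 hp)) ((hdvd ((hmem _).1 hq)).mul_right _)⟩
  push Not at hall
  obtain ⟨p, q, hpq, hq⟩ := hall
  rw [hmem] at hq
  obtain ⟨u, v, huv⟩ : IsCoprime q g :=
    ((hgp.irreducible.coprime_iff_not_dvd).2 hq).symm
  -- Since `u` inverts `q` modulo `g`, the element `u (p + qY)` is congruent to `c + Y` modulo `P`.
  set c := u * p with hcdef
  have hc : ofX W c + coordY W ∈ P := by
    have h1 := P.mul_mem_left (ofX W u) hpq
    have h2 := P.mul_mem_left (ofX W v * coordY W) hgP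
    have h3 := congrArg (ofX W) huv
    simp only [map_add, map_mul, map_one] at h3
    have := P.add_mem h1 h2
    convert this using 1
    rw [hcdef, map_mul]
    linear_combination (-coordY W) * h3
  have hnorm := mul_conj W c 1
  rw [map_one, one_mul, one_mul] at hnorm
  have hNP : ofX W (c ^ 2 - c * 1 * linPoly W - 1 ^ 2 * cubPoly W) ∈ P := by
    rw [← hnorm]; exact P.mul_mem_right _ hc
  obtain ⟨s, hs⟩ := (hmem _).1 hNP
  -- If `g ^ 2` divided the norm of `c + Y`, the derivative of the norm would lie in `P`. Modulo `c
  -- + Y` and the `Y`-derivative, both in `P`, it equals the `X`-derivative, which is not in `P`.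
  have hsP : ofX W s ∉ P := by
    intro hsP
    obtain ⟨s', hs'⟩ := (hmem _).1 hsP
    have hX := (partial_notMem W P).resolve_right (fun h => h hY)
    apply hX
    have hd := congrArg derivative hs
    rw [hs'] at hd
    have hd2 : g ∣ derivative (g * (g * s')) := by
      simp only [derivative_mul]
      exact ⟨derivative g * s' + (derivative g * s' + g * derivative s'), by ring⟩
    rw [← hd, ← hmem] at hd2
    simp only [derivative_mul, derivative_pow, derivative_X,
      derivative_C, derivative_one, map_sub, map_add, map_mul, map_pow, map_one, map_zero, map_natCast] at hd2
    have h4 := P.mul_mem_left (ofX W (C W.a₁) - ofX W (derivative c) * 2) hc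
    have h5 := P.mul_mem_left (ofX W (derivative c)) hY
    convert P.add_mem (P.add_mem hd2 h4) h5 using 1
    simp only [map_add, map_mul, map_pow, map_ofNat]
    push_cast
    simp
    ring
  refine ⟨_, hc, fun a ha => ?_⟩
  obtain ⟨p, q, rfl⟩ := exists_eq_ofX_add W a
  refine ⟨ofX W s, hsP, ?_⟩
  have h1 : ofX W (p - q * c) ∈ P := by
    have := P.sub_mem ha (P.mul_mem_left (ofX W q) hc)
    convert this using 1
    simp only [map_sub, map_mul]; ring
  obtain ⟨r, hr⟩ := (hmem _).1 h1
  have h2 : ofX W s * (ofX W p + ofX W q * coordY W) =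
      ofX W s * ofX W q * (ofX W c + coordY W) + ofX W (g * s) * ofX W r := by
    have := congrArg (ofX W) hr
    simp only [map_sub, map_mul] at this ⊢
    linear_combination (ofX W s) * this
  rw [h2, ← hs, ← hnorm]
  exact dvd_add (dvd_mul_left _ _) (by rw [mul_assoc]; exact dvd_mul_right _ _)

instance [W.IsElliptic] : IsDedekindDomain W.CoordinateRing :=
  isDedekindDomain_of_locally_principal fun P _ hP0 => exists_locally_principal W P hP0

end

end WeierstrassCurve.Affine.CoordinateRing

/-! ### Additivity of the colength of ideals -/

section
variable {K R : Type*} [Field K] [CommRing R] [Algebra K R] [IsDedekindDomain R]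

/-- No ideal lies strictly between `I * P` and `I`, so any `a` in `I` outside `I * P` generates `I`
modulo `I * P`. Multiplication by `a` thus identifies `R ⧸ P` with the kernel of `R ⧸ I * P → R ⧸
I`. -/
theorem Ideal.finrank_quotient_mul_of_isMaximal {I P : Ideal R} (hI : I ≠ ⊥) (hP : P.IsMaximal)
    [Module.Finite K (R ⧸ I * P)] :
    Module.finrank K (R ⧸ I * P) = Module.finrank K (R ⧸ I) + Module.finrank K (R ⧸ P) := by
  have hlt : I * P < I := by
    refine lt_of_le_of_ne Ideal.mul_le_left fun h => hP.ne_top ?_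
    have : I * P = I * ⊤ := by rw [h, Ideal.mul_top]
    exact mul_left_cancel₀ hI this
  obtain ⟨a, haI, ha⟩ := SetLike.exists_of_lt hlt
  have hsup : Ideal.span {a} ⊔ I * P = I := by
    have hle : Ideal.span {a} ⊔ I * P ≤ I :=
      sup_le ((Ideal.span_singleton_le_iff_mem _).2 haI) Ideal.mul_le_left
    obtain ⟨J, hJ⟩ := Ideal.dvd_iff_le.2 hle
    have h1 : P ≤ J := by
      have : I * P ≤ I * J := hJ ▸ le_sup_right
      have := Ideal.dvd_iff_le.2 this
      exact Ideal.dvd_iff_le.1 ((mul_dvd_mul_iff_left hI).1 this)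
    rcases eq_or_ne J ⊤ with h | h
    swap
    · replace h := hP.eq_of_le h h1
      exfalso
      apply ha
      rw [h, ← hJ]
      exact (le_sup_left : _ ≤ Ideal.span {a} ⊔ I * P) (Ideal.mem_span_singleton_self a)
    · rw [hJ, h, Ideal.mul_top]
  let φ : R →ₗ[R] R ⧸ I * P := LinearMap.toSpanSingleton R _ (Ideal.Quotient.mk _ a)
  have hφ : ∀ r, φ r = Ideal.Quotient.mk (I * P) (r * a) := fun r => by
    simp [φ, Algebra.smul_def]
  have hker : LinearMap.ker φ = P := by
    have h1 : P ≤ LinearMap.ker φ := fun r hr => by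
      rw [LinearMap.mem_ker, hφ, Ideal.Quotient.eq_zero_iff_mem, mul_comm r a]
      exact Ideal.mul_mem_mul haI hr
    refine (hP.eq_of_le ?_ h1).symm
    intro h
    have : (1 : R) ∈ LinearMap.ker φ := h ▸ Submodule.mem_top
    rw [LinearMap.mem_ker, hφ, Ideal.Quotient.eq_zero_iff_mem, one_mul] at this
    exact ha this
  let N : Submodule R (R ⧸ I * P) := Submodule.map (Submodule.mkQ (I * P)) I
  have hrange : LinearMap.range φ = N := by
    ext z
    constructor
    · rintro ⟨r, rfl⟩
      rw [hφ]
      exact ⟨r * a, I.mul_mem_left _ haI, rfl⟩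
    · rintro ⟨b, hb, rfl⟩
      have hb' : b ∈ Ideal.span {a} ⊔ I * P := by rw [hsup]; exact hb
      obtain ⟨c, hc, d, hd, rfl⟩ := Submodule.mem_sup.1 hb'
      obtain ⟨r, rfl⟩ := Ideal.mem_span_singleton'.1 hc
      refine ⟨r, ?_⟩
      rw [hφ]
      change _ = Ideal.Quotient.mk (I * P) (r * a + d)
      rw [map_add, Ideal.Quotient.eq_zero_iff_mem.2 hd, add_zero]
  have e1 : Module.finrank K N = Module.finrank K (R ⧸ P) := by
    rw [← hrange]
    have e := φ.quotKerEquivRange.restrictScalars K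
    rw [← e.finrank_eq, hker]
  have e2 : Module.finrank K ((R ⧸ I * P) ⧸ N) = Module.finrank K (R ⧸ I) :=
    ((Submodule.quotientQuotientEquivQuotient (I * P) I Ideal.mul_le_left).restrictScalars
      K).finrank_eq
  have e3 := Submodule.finrank_quotient_add_finrank (N.restrictScalars K)
  rw [← e3, ← e1, ← e2]
  rfl

theorem Ideal.finrank_quotient_mul (hfin : ∀ I : Ideal R, I ≠ ⊥ → Module.Finite K (R ⧸ I))
    {I J : Ideal R} (hI : I ≠ ⊥) (hJ : J ≠ ⊥) :
    Module.finrank K (R ⧸ I * J) = Module.finrank K (R ⧸ I) + Module.finrank K (R ⧸ J) := by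
  induction J using UniqueFactorizationMonoid.induction_on_prime generalizing I with
  | h₁ => exact absurd rfl hJ
  | h₂ J h =>
    rw [Ideal.isUnit_iff.1 h, Ideal.mul_top]
    simp only [left_eq_add]
    exact Module.finrank_zero_of_subsingleton
  | h₃ J P hJ0 hP ih =>
    have hP0 : P ≠ ⊥ := hP.ne_zero
    have hPm : P.IsMaximal := (Ideal.isPrime_of_prime hP).isMaximal hP0
    have := hfin _ (mul_ne_zero (mul_ne_zero hI hJ0) hP0)
    have := hfin _ (mul_ne_zero hJ0 hP0)
    rw [mul_comm P J, ← mul_assoc,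
      Ideal.finrank_quotient_mul_of_isMaximal (K := K) (mul_ne_zero hI hJ0) hPm,
      Ideal.finrank_quotient_mul_of_isMaximal (K := K) hJ0 hPm, ih hI hJ0, add_assoc]

end

/-! ### Pole orders at infinity and functions in a given ideal -/

namespace WeierstrassCurve.Affine.CoordinateRing

section
variable {K : Type*} [Field K] (W : WeierstrassCurve.Affine K)

/-- The degree of a function in the coordinate ring, i.e. its pole order at infinity. -/
noncomputable def deg (a : W.CoordinateRing) : ℕ := (Algebra.norm K[X] a).natDegree

theorem finrank_quotient_span_singleton {a : W.CoordinateRing} (ha : a ≠ 0) :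
    Module.finrank K (W.CoordinateRing ⧸ Ideal.span {a}) = deg W a :=
  finrank_quotient_span_eq_natDegree_norm (CoordinateRing.basis W) ha

/-- By integrality `I` contains a nonzero polynomial `g` in `X`, and the quotient is spanned by `1`
and `Y` over the finite `K`-algebra `K[X] ⧸ (g)`. -/
theorem finite_quotient {I : Ideal W.CoordinateRing} (hI : I ≠ ⊥) :
    Module.Finite K (W.CoordinateRing ⧸ I) := by
  obtain ⟨a, ha, ha0⟩ := Submodule.exists_mem_ne_zero_of_ne_bot hI
  have hp0 : I.comap (ofX W) ≠ ⊥ := by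
    rw [ofX_eq_algebraMap]
    exact Ideal.comap_ne_bot_of_integral_mem ha0 ha (Algebra.IsIntegral.isIntegral _)
  obtain ⟨g, hg, hg0⟩ := Submodule.exists_mem_ne_zero_of_ne_bot hp0
  have h1 : Module.Finite K (K[X] ⧸ Ideal.span {g}) := (AdjoinRoot.powerBasis hg0).finite
  let f : K[X] ⧸ Ideal.span {g} →ₐ[K] W.CoordinateRing ⧸ I := Ideal.quotientMapₐ I
    (IsScalarTower.toAlgHom K K[X] W.CoordinateRing) ((Ideal.span_singleton_le_iff_mem _).2 hg)
  refine Module.Finite.of_surjective (f.toLinearMap.coprod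
    (LinearMap.mulRight K (Ideal.Quotient.mk I (coordY W)) ∘ₗ f.toLinearMap)) fun z => ?_
  obtain ⟨a, rfl⟩ := Ideal.Quotient.mk_surjective z
  obtain ⟨p, q, rfl⟩ := exists_eq_ofX_add W a
  exact ⟨⟨Ideal.Quotient.mk _ p, Ideal.Quotient.mk _ q⟩, rfl⟩

theorem finrank_quotient_mul [W.IsElliptic] {I J : Ideal W.CoordinateRing} (hI : I ≠ ⊥)
    (hJ : J ≠ ⊥) : Module.finrank K (W.CoordinateRing ⧸ I * J) =
      Module.finrank K (W.CoordinateRing ⧸ I) + Module.finrank K (W.CoordinateRing ⧸ J) :=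
  Ideal.finrank_quotient_mul (fun _ h => finite_quotient W h) hI hJ

theorem finrank_quotient_XYIdeal {x y : K} (h : W.Equation x y) :
    Module.finrank K (W.CoordinateRing ⧸ XYIdeal W x (C y)) = 1 := by
  rw [(quotientXYIdealEquiv h).toLinearEquiv.finrank_eq, Module.finrank_self]

theorem isMaximal_XYIdeal {x y : K} (h : W.Equation x y) : (XYIdeal W x (C y)).IsMaximal :=
  Ideal.Quotient.maximal_of_isField _
    ((quotientXYIdealEquiv h).toMulEquiv.isField (Field.toIsField K))

theorem XYIdeal_ne_bot (x : K) (y : K[X]) : XYIdeal W x y ≠ ⊥ := fun h => by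
  have : XClass W x ∈ XYIdeal W x y := Ideal.subset_span (by simp)
  rw [h] at this
  exact XClass_ne_zero x this

/-- Every residue class is a constant; the constants `x` and `y` of the two coordinate functions
satisfy the equation, and `J` contains the maximal ideal generated by `X - x` and `Y - y`. -/
theorem eq_XYIdeal_of_finrank_eq_one {J : Ideal W.CoordinateRing}
    (hJ : Module.finrank K (W.CoordinateRing ⧸ J) = 1) :
    ∃ x y, W.Equation x y ∧ J = XYIdeal W x (C y) := by
  have hnt : Nontrivial (W.CoordinateRing ⧸ J) := by
    apply Module.nontrivial_of_finrank_pos (R := K); omega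
  have hs : ∀ z : W.CoordinateRing ⧸ J, ∃ c : K, algebraMap K _ c = z := fun z => by
    obtain ⟨c, hc⟩ := (finrank_eq_one_iff_of_nonzero' (1 : W.CoordinateRing ⧸ J) one_ne_zero).1 hJ z
    exact ⟨c, by rw [← hc, Algebra.smul_def, mul_one]⟩
  obtain ⟨x, hx⟩ := hs (Ideal.Quotient.mk J (ofX W X))
  obtain ⟨y, hy⟩ := hs (Ideal.Quotient.mk J (coordY W))
  have hc : ∀ c : K, algebraMap K (W.CoordinateRing ⧸ J) c = Ideal.Quotient.mk J (ofX W (C c)) :=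
    fun c => rfl
  have heq : W.Equation x y := by
    rw [equation_iff']
    apply (algebraMap K (W.CoordinateRing ⧸ J)).injective
    have h := congrArg (Ideal.Quotient.mk J) (coordY_sq W)
    simp only [map_sub, map_mul, map_pow, map_add, ← hc, ← hx, ← hy] at h
    simp only [map_sub, map_mul, map_pow, map_add, map_zero]
    linear_combination h
  refine ⟨x, y, heq, ((isMaximal_XYIdeal W heq).eq_of_le ?_ ?_).symm⟩
  · exact Ideal.Quotient.nontrivial_iff.1 hnt
  · rw [XYIdeal, Ideal.span_le]
    rintro _ (rfl | rfl)
    · change XClass W x ∈ J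
      rw [← Ideal.Quotient.eq_zero_iff_mem]
      have : XClass W x = ofX W X - ofX W (C x) := by simp [XClass]
      rw [this, map_sub, ← hx, hc, sub_self]
    · change YClass W (C y) ∈ J
      rw [← Ideal.Quotient.eq_zero_iff_mem]
      have : YClass W (C y) = coordY W - ofX W (C y) := by simp [YClass]
      rw [this, map_sub, ← hy, hc, sub_self]

theorem deg_ofX_add_le {p q : K[X]} {n : ℕ} (hn : 0 < n) (hp : p.degree < (n / 2 + 1 : ℕ))
    (hq : q.degree < ((n - 1) / 2 : ℕ)) : deg W (ofX W p + ofX W q * coordY W) ≤ n := by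
  rw [deg, ofX_add_eq_smul, natDegree_le_iff_degree_le, degree_norm_smul_basis]
  apply max_le
  · by_cases hp0 : p = 0
    · simp [hp0]
    · rw [degree_eq_natDegree hp0] at hp ⊢
      have := Nat.cast_lt.1 hp
      rw [nsmul_eq_mul]
      norm_cast
      omega
  · by_cases hq0 : q = 0
    · simp [hq0]
    · rw [degree_eq_natDegree hq0] at hq ⊢
      have := Nat.cast_lt.1 hq
      rw [nsmul_eq_mul]
      norm_cast
      omega

/-- With `d` the colength of `I`, a space of dimension `d + 1` of functions with pole order at most
`d + 1` cannot inject into the quotient by `I`. This is the only form of Riemann-Roch that is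
needed. -/
theorem exists_mem_deg_le {I : Ideal W.CoordinateRing} (hI : I ≠ ⊥) :
    ∃ f ∈ I, f ≠ 0 ∧ deg W f ≤ Module.finrank K (W.CoordinateRing ⧸ I) + 1 := by
  have := finite_quotient W hI
  set d := Module.finrank K (W.CoordinateRing ⧸ I) with hd
  let ι : K[X] →ₗ[K] W.CoordinateRing := (Algebra.linearMap K[X] W.CoordinateRing).restrictScalars K
  -- The pairs `(p, q)` with `2 deg p ≤ d + 1` and `2 deg q + 3 ≤ d + 1`, sent to `p + qY`. The two
  -- dimensions add up to `d + 1` for either parity of `d`.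
  let ψ : (degreeLT K ((d + 1) / 2 + 1) × degreeLT K ((d + 1 - 1) / 2)) →ₗ[K] W.CoordinateRing :=
    (ι ∘ₗ Submodule.subtype _).coprod
      (LinearMap.mulRight K (coordY W) ∘ₗ ι ∘ₗ Submodule.subtype _)
  let θ := (Submodule.mkQ I).restrictScalars K ∘ₗ ψ
  have hV : Module.finrank K (degreeLT K ((d + 1) / 2 + 1) × degreeLT K ((d + 1 - 1) / 2)) = d + 1 := by
    rw [Module.finrank_prod, (degreeLTEquiv K _).finrank_eq, (degreeLTEquiv K _).finrank_eq,
      Module.finrank_fin_fun, Module.finrank_fin_fun]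
    omega
  have : Module.Finite K (degreeLT K ((d + 1) / 2 + 1)) := .equiv (degreeLTEquiv K _).symm
  have : Module.Finite K (degreeLT K ((d + 1 - 1) / 2)) := .equiv (degreeLTEquiv K _).symm
  have hker : LinearMap.ker θ ≠ ⊥ := LinearMap.ker_ne_bot_of_finrank_lt (by omega)
  obtain ⟨v, hv, hv0⟩ := Submodule.exists_mem_ne_zero_of_ne_bot hker
  refine ⟨ψ v, ?_, fun h => hv0 ?_, ?_⟩
  · exact (Submodule.Quotient.mk_eq_zero I).1 hv
  · obtain ⟨h1, h2⟩ := ofX_add_eq_zero W h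
    exact Prod.ext (Subtype.ext h1) (Subtype.ext h2)
  · exact deg_ofX_add_le W (by omega) (mem_degreeLT.1 v.1.2) (mem_degreeLT.1 v.2.2)

end

end WeierstrassCurve.Affine.CoordinateRing

/-! ### Every ideal class comes from a point -/

namespace WeierstrassCurve.Affine.Point
open CoordinateRing nonZeroDivisors
variable {K : Type*} [Field K] [DecidableEq K] {W : WeierstrassCurve.Affine K}

/-- Choose `f` in `I` with pole order at most one more than the colength of `I`, and write `(f) = I
* J`. By additivity `J` has colength at most one, so it is the unit ideal or the ideal of a point
`P`. The class of `I` is then that of `-P`. -/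
theorem toClass_surjective [W.IsElliptic] : Function.Surjective (toClass (W := W)) := by
  intro c
  obtain ⟨I, hI⟩ := ClassGroup.mk0_surjective (R := W.CoordinateRing) c.toMul
  have hI0 : (I : Ideal W.CoordinateRing) ≠ ⊥ := nonZeroDivisors.coe_ne_zero I
  obtain ⟨f, hfI, hf0, hf⟩ := exists_mem_deg_le W hI0
  obtain ⟨J, hJ⟩ := Ideal.dvd_iff_le.2 ((Ideal.span_singleton_le_iff_mem _).2 hfI)
  have hspan : Ideal.span {f} ≠ ⊥ := by simpa using hf0
  have hJ0 : J ≠ ⊥ := by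
    rintro rfl
    exact hspan (by rw [hJ, Ideal.mul_bot])
  have hdim : Module.finrank K (W.CoordinateRing ⧸ J) ≤ 1 := by
    have := finrank_quotient_mul W hI0 hJ0
    rw [← hJ, finrank_quotient_span_singleton W hf0] at this
    omega
  have hclass : ∃ P : W.Point, (toClass P).toMul =
      ClassGroup.mk0 ⟨J, mem_nonZeroDivisors_of_ne_zero hJ0⟩ := by
    rcases Nat.le_one_iff_eq_zero_or_eq_one.1 hdim with h | h
    · have := finite_quotient W hJ0
      have := Module.finrank_zero_iff.1 h
      have hJt : J = ⊤ := Ideal.Quotient.subsingleton_iff.1 this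
      refine ⟨0, ?_⟩
      rw [toClass_zero, toMul_zero, eq_comm, ClassGroup.mk0_eq_one_iff]
      simp only [hJt]
      exact ⟨⟨1, by simp⟩⟩
    · obtain ⟨x, y, hxy, rfl⟩ := eq_XYIdeal_of_finrank_eq_one W h
      refine ⟨.some x y (equation_iff_nonsingular.1 hxy), ?_⟩
      change ClassGroup.mk W.FunctionField (XYIdeal' (W := W) _) = _
      rw [← ClassGroup.mk_mk0 W.FunctionField]
      congr 1
      ext1
      rw [XYIdeal'_eq, FractionalIdeal.coe_mk0]
  obtain ⟨P, hP⟩ := hclass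
  refine ⟨-P, ?_⟩
  apply Additive.toMul.injective
  rw [map_neg, toMul_neg, hP, ← hI, inv_eq_iff_mul_eq_one, ← map_mul,
    ClassGroup.mk0_eq_one_iff, mul_comm]
  exact ⟨⟨f, by simpa using hJ.symm⟩⟩

end WeierstrassCurve.Affine.Point

/-! ### Places from valuations and from maximal ideals -/

namespace FunctionFieldDivisor.Place

section
variable {K F : Type*} [Field K] [Field F] [Algebra K F]

theorem val_eq_exp (P : Place K F) {f : F} (hf : f ≠ 0) : P.val f = WithZero.exp (-P.ord f) := by
  rw [ord, neg_neg, WithZero.exp_log ((Valuation.ne_zero_iff _).2 hf)]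

theorem ord_add_eq_of_lt (P : Place K F) {f g : F} (hf : f ≠ 0) (hg : g ≠ 0)
    (h : P.ord f < P.ord g) : f + g ≠ 0 ∧ P.ord (f + g) = P.ord f := by
  have h1 : P.val g < P.val f := by
    rw [P.val_eq_exp hf, P.val_eq_exp hg, WithZero.exp_lt_exp]; omega
  have h2 := Valuation.map_add_eq_of_lt_left _ h1
  exact ⟨fun h0 => (Valuation.ne_zero_iff _).2 hf (by rw [← h2, h0, map_zero]), by
    rw [ord, h2, ord]⟩

theorem le_ord_add (P : Place K F) {f g : F} {n : ℤ} (hfg : f + g ≠ 0) (hf : f ≠ 0 → n ≤ P.ord f)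
    (hg : g ≠ 0 → n ≤ P.ord g) : n ≤ P.ord (f + g) := by
  have key : ∀ {f : F}, (f ≠ 0 → n ≤ P.ord f) → P.val f ≤ WithZero.exp (-n) := by
    intro f hf
    by_cases hf0 : f = 0
    · simp [hf0]
    · rw [P.val_eq_exp hf0, WithZero.exp_le_exp]
      have := hf hf0
      omega
  have h := (P.val.map_add f g).trans (max_le (key hf) (key hg))
  rw [P.val_eq_exp hfg, WithZero.exp_le_exp] at h
  omega

theorem ord_algebraMap_const (P : Place K F) {c : K} (hc : c ≠ 0) : P.ord (algebraMap K F c) = 0 := by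
  have h1 := (P.mem_ring_iff ((_root_.map_ne_zero _).2 hc)).1 (P.algebraMap_mem c)
  have h2 := (P.mem_ring_iff ((_root_.map_ne_zero _).2 (inv_ne_zero hc))).1 (P.algebraMap_mem c⁻¹)
  rw [map_inv₀, ord_inv] at h2
  omega

theorem eq_of_ord {P Q : Place K F} (h : ∀ f : F, f ≠ 0 → (0 ≤ P.ord f ↔ 0 ≤ Q.ord f)) : P = Q := by
  apply ext_ring
  ext f
  by_cases hf : f = 0
  · simp [hf]
  · rw [P.mem_ring_iff hf, Q.mem_ring_iff hf, h f hf]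

/-- The place of a normalized discrete valuation that is trivial on the constants. -/
noncomputable def ofValuation (v : Valuation F (WithZero (Multiplicative ℤ)))
    (hK : ∀ c : K, v (algebraMap K F c) ≤ 1) (hv : ∃ t, v t = WithZero.exp (-1)) : Place K F where
  ring := v.valuationSubring
  algebraMap_mem := hK
  isDVR := by
    obtain ⟨t, ht⟩ := hv
    have : v.IsNontrivial := ⟨t, by simp [ht], by
      rw [ht, ← WithZero.exp_zero, Ne, WithZero.exp_inj]; decide⟩
    infer_instance

/-- The place and `v` have the same valuation ring, hence the same units, so the logarithm of `v` is
a constant multiple of the order. The value `exp (-1)` forces the constant to be `±1`, and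
integrality of a uniformizer fixes the sign. -/
theorem ord_ofValuation (v : Valuation F (WithZero (Multiplicative ℤ)))
    (hK : ∀ c : K, v (algebraMap K F c) ≤ 1) (hv : ∃ t, v t = WithZero.exp (-1)) {f : F}
    (hf : f ≠ 0) : (ofValuation v hK hv).ord f = -WithZero.log (v f) := by
  set P := ofValuation v hK hv with hP
  have hw : ∀ f : F, f ≠ 0 → (0 ≤ P.ord f ↔ 0 ≤ -WithZero.log (v f)) := fun f hf => by
    rw [← P.mem_ring_iff hf]
    change v f ≤ 1 ↔ _
    rw [← WithZero.log_le_log ((Valuation.ne_zero_iff _).2 hf) one_ne_zero, WithZero.log_one]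
    omega
  have hzero : ∀ f : F, f ≠ 0 → P.ord f = 0 → WithZero.log (v f) = 0 := fun f hf h => by
    have h1 := (hw f hf).1 h.ge
    have h2 := (hw f⁻¹ (inv_ne_zero hf)).1 (by rw [ord_inv, h]; rfl)
    rw [map_inv₀, WithZero.log_inv] at h2
    omega
  obtain ⟨t, ht0, ht⟩ := P.exists_ord_eq_one
  have key : ∀ f : F, f ≠ 0 → WithZero.log (v f) = P.ord f * WithZero.log (v t) := fun f hf => by
    have h := hzero (f * t ^ (-P.ord f)) (mul_ne_zero hf (zpow_ne_zero _ ht0)) (by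
      rw [P.ord_mul hf (zpow_ne_zero _ ht0), ord_zpow, ht]; ring)
    rw [map_mul, map_zpow₀, WithZero.log_mul ((Valuation.ne_zero_iff _).2 hf)
      (zpow_ne_zero _ ((Valuation.ne_zero_iff _).2 ht0)), WithZero.log_zpow] at h
    simp only [smul_eq_mul] at h
    linarith
  have ht1 : WithZero.log (v t) = -1 := by
    obtain ⟨s, hs⟩ := hv
    have hs0 : s ≠ 0 := by rintro rfl; rw [map_zero] at hs; exact WithZero.exp_ne_zero hs.symm
    have h1 := key s hs0
    rw [hs, WithZero.log_exp] at h1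
    have h2 := (hw t ht0).1 (by rw [ht]; exact zero_le_one)
    rcases Int.mul_eq_neg_one_iff_eq_one_or_neg_one.1 h1.symm with h | h
    · exact h.2
    · rw [h.2] at h2; omega
  rw [key f hf, ht1]; ring

/-- There are no proper inclusions between places. -/
theorem eq_of_ring_le {P Q : Place K F} (h : P.ring ≤ Q.ring) : P = Q := by
  obtain ⟨t, ht0, ht⟩ := P.exists_ord_eq_one
  have hu : ∀ f : F, f ≠ 0 → P.ord f = 0 → Q.ord f = 0 := fun f hf hf0 => by
    have h1 := (Q.mem_ring_iff hf).1 (h ((P.mem_ring_iff hf).2 hf0.ge))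
    have h2 := (Q.mem_ring_iff (inv_ne_zero hf)).1 (h ((P.mem_ring_iff (inv_ne_zero hf)).2 (by
      rw [ord_inv, hf0]; rfl)))
    rw [ord_inv] at h2
    omega
  -- Units of `P` are units of `Q`, so one order is a multiple of the other. The factor is positive
  -- because `Q.ord` takes the value `1`.
  have key : ∀ f : F, f ≠ 0 → Q.ord f = P.ord f * Q.ord t := fun f hf => by
    have h := hu (f * t ^ (-P.ord f)) (mul_ne_zero hf (zpow_ne_zero _ ht0)) (by
      rw [P.ord_mul hf (zpow_ne_zero _ ht0), ord_zpow, ht]; ring)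
    rw [Q.ord_mul hf (zpow_ne_zero _ ht0), ord_zpow] at h
    linarith
  have ht' : 0 < Q.ord t := by
    have h1 := (Q.mem_ring_iff ht0).1 (h ((P.mem_ring_iff ht0).2 (by rw [ht]; exact zero_le_one)))
    rcases h1.lt_or_eq with h2 | h2
    · exact h2
    · obtain ⟨s, hs0, hs⟩ := Q.exists_ord_eq_one
      rw [key s hs0, ← h2] at hs
      omega
  refine eq_of_ord fun f hf => ?_
  rw [key f hf, mul_nonneg_iff_of_pos_right ht']

theorem residue_eq_zero_iff (P : Place K F) (x : P.ring) :
    IsLocalRing.residue P.ring x = 0 ↔ (x : F) = 0 ∨ 0 < P.ord x := by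
  rw [IsLocalRing.residue_eq_zero_iff, IsLocalRing.mem_maximalIdeal, mem_nonunits_iff, P.isUnit_iff]
  by_cases hx : (x : F) = 0
  · simp [hx]
  · have := (P.mem_ring_iff hx).1 x.2
    simp only [hx, ne_eq, not_false_eq_true, true_and, false_or]
    omega

/-- A place is of degree one if modulo its maximal ideal every function is congruent to a
constant. -/
theorem degree_eq_one (P : Place K F) (h : ∀ f : F, f ≠ 0 → P.ord f = 0 →
    ∃ c : K, f = algebraMap K F c ∨ 0 < P.ord (f - algebraMap K F c)) : P.degree = 1 := by
  refine (finrank_eq_one_iff_of_nonzero' (1 : IsLocalRing.ResidueField P.ring) one_ne_zero).2 ?_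
  intro z
  obtain ⟨x, rfl⟩ := IsLocalRing.residue_surjective z
  by_cases hx : IsLocalRing.residue P.ring x = 0
  · exact ⟨0, by rw [hx, zero_smul]⟩
  rw [residue_eq_zero_iff, not_or] at hx
  have h0 := (P.mem_ring_iff hx.1).1 x.2
  obtain ⟨c, hc⟩ := h x hx.1 (by omega)
  refine ⟨c, ?_⟩
  rw [Algebra.smul_def, mul_one, eq_comm, ← sub_eq_zero]
  change IsLocalRing.residue P.ring x - IsLocalRing.residue P.ring (algebraMap K P.ring c) = 0
  rw [← map_sub, residue_eq_zero_iff]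
  refine hc.imp (fun h => ?_) fun h => h
  change (x : F) - algebraMap K F c = 0
  rw [h, sub_self]

end

section
open IsDedekindDomain
variable {K A F : Type*} [Field K] [CommRing A] [IsDedekindDomain A] [Field F] [Algebra K A]
  [Algebra A F] [Algebra K F] [IsScalarTower K A F] [IsFractionRing A F]

variable (K F) in
/-- The place of a maximal ideal of a Dedekind domain. -/
noncomputable def ofPrime (v : HeightOneSpectrum A) : Place K F :=
  ofValuation (v.valuation F)
    (fun c => by rw [IsScalarTower.algebraMap_apply K A F]; exact v.valuation_le_one _)
    (v.valuation_exists_uniformizer F)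

theorem ord_ofPrime (v : HeightOneSpectrum A) {f : F} (hf : f ≠ 0) :
    (ofPrime K F v).ord f = -WithZero.log (v.valuation F f) := ord_ofValuation _ _ _ hf

theorem mem_ofPrime_ring (v : HeightOneSpectrum A) (f : F) :
    f ∈ (ofPrime K F v).ring ↔ v.valuation F f ≤ 1 := Iff.rfl

theorem ord_ofPrime_pos_iff (v : HeightOneSpectrum A) {a : A} (ha : a ≠ 0) :
    0 < (ofPrime K F v).ord (algebraMap A F a) ↔ a ∈ v.asIdeal := by
  have hne := (map_ne_zero_iff _ (IsFractionRing.injective A F)).2 ha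
  rw [ord_ofPrime v hne, ← v.valuation_lt_one_iff_mem (K := F) a,
    ← WithZero.log_lt_log ((Valuation.ne_zero_iff _).2 hne) one_ne_zero, WithZero.log_one]
  exact neg_pos

theorem ord_ofPrime_nonneg (v : HeightOneSpectrum A) {a : A} (ha : a ≠ 0) :
    0 ≤ (ofPrime K F v).ord (algebraMap A F a) := by
  have hne := (map_ne_zero_iff _ (IsFractionRing.injective A F)).2 ha
  rw [← mem_ring_iff _ hne, mem_ofPrime_ring]
  exact v.valuation_le_one a

theorem ofPrime_injective : Function.Injective (ofPrime K F : HeightOneSpectrum A → Place K F) := by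
  intro v w h
  ext a
  by_cases ha : a = 0
  · simp [ha]
  · rw [← ord_ofPrime_pos_iff (K := K) (F := F) v ha, h, ord_ofPrime_pos_iff w ha]

/-- A place that is finite on a Dedekind domain is the place of a maximal ideal. -/
theorem exists_eq_ofPrime (P : Place K F) (h : ∀ a : A, algebraMap A F a ∈ P.ring) :
    ∃ v : HeightOneSpectrum A, P = ofPrime K F v := by
  let f : A →+* P.ring := (algebraMap A F).codRestrict P.ring h
  let I : Ideal A := (IsLocalRing.maximalIdeal P.ring).comap f
  have hI : ∀ a : A, a ≠ 0 → (a ∈ I ↔ 0 < P.ord (algebraMap A F a)) := fun a ha => by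
    have hne := (map_ne_zero_iff _ (IsFractionRing.injective A F)).2 ha
    rw [Ideal.mem_comap, ← IsLocalRing.residue_eq_zero_iff, residue_eq_zero_iff]
    change algebraMap A F a = 0 ∨ 0 < P.ord (algebraMap A F a) ↔ _
    simp [ha]
  -- If the centre `I` of `P` on `A` were zero, all nonzero elements of `A`, and hence all nonzero
  -- fractions, would have order zero.
  have hbot : I ≠ ⊥ := by
    intro hb
    have h0 : ∀ a : A, a ≠ 0 → P.ord (algebraMap A F a) = 0 := fun a ha => by
      have hne := (map_ne_zero_iff _ (IsFractionRing.injective A F)).2 ha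
      have h1 := (P.mem_ring_iff hne).1 (h a)
      have h2 : a ∉ I := by rw [hb]; exact ha
      rw [hI a ha] at h2
      omega
    obtain ⟨t, ht0, ht⟩ := P.exists_ord_eq_one
    obtain ⟨a, b, hb, rfl⟩ := IsFractionRing.div_surjective A t
    have hb0 := nonZeroDivisors.ne_zero hb
    have ha0 : a ≠ 0 := by rintro rfl; simp at ht0
    rw [div_eq_mul_inv, ord_mul, ord_inv, h0 a ha0, h0 b hb0] at ht
    · omega
    · exact (map_ne_zero_iff _ (IsFractionRing.injective A F)).2 ha0
    · exact inv_ne_zero ((map_ne_zero_iff _ (IsFractionRing.injective A F)).2 hb0)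
  -- One inclusion is enough: a function integral at `I` has a denominator outside `I`, which is a
  -- unit at `P`.
  refine ⟨⟨I, Ideal.comap_isPrime _ _, hbot⟩, (eq_of_ring_le fun x hx => ?_).symm⟩
  rw [mem_ofPrime_ring] at hx
  obtain ⟨n, ⟨d, hd⟩, hnd⟩ := HeightOneSpectrum.exists_primeCompl_mul_eq_of_integer _ x hx
  have hd0 : d ≠ 0 := by rintro rfl; exact hd (Ideal.zero_mem I)
  have hne := (map_ne_zero_iff _ (IsFractionRing.injective A F)).2 hd0
  have hd1 : P.ord (algebraMap A F d) = 0 := by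
    have h1 := (P.mem_ring_iff hne).1 (h d)
    have h2 : d ∉ I := hd
    rw [hI d hd0] at h2
    omega
  have : x = algebraMap A F n * (algebraMap A F d)⁻¹ := by
    rw [← hnd]; exact (mul_inv_cancel_right₀ hne x).symm
  rw [this]
  exact P.ring.mul_mem _ _ (h n) ((P.mem_ring_iff (inv_ne_zero hne)).2 (by rw [ord_inv, hd1]; rfl))

/-- The degree of the place of a maximal ideal. -/
theorem degree_ofPrime (v : HeightOneSpectrum A) :
    (ofPrime K F v).degree = Module.finrank K (A ⧸ v.asIdeal) := by
  set P := ofPrime K F v with hP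
  have h : ∀ a : A, algebraMap A F a ∈ P.ring := fun a => v.valuation_le_one a
  let f : A →ₐ[K] IsLocalRing.ResidueField P.ring :=
    { toRingHom := (IsLocalRing.residue P.ring).comp ((algebraMap A F).codRestrict P.ring h)
      commutes' := fun c => congrArg (IsLocalRing.residue P.ring) (Subtype.ext
        (IsScalarTower.algebraMap_apply K A F c).symm) }
  have hf0 : ∀ a, f a = 0 ↔ a ∈ v.asIdeal := fun a => by
    change IsLocalRing.residue P.ring ((algebraMap A F).codRestrict P.ring h a) = 0 ↔ _
    rw [residue_eq_zero_iff]
    change algebraMap A F a = 0 ∨ 0 < P.ord (algebraMap A F a) ↔ _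
    by_cases ha : a = 0
    · simp [ha]
    · rw [hP, ord_ofPrime_pos_iff v ha]
      simp [ha]
  have hker : RingHom.ker f = v.asIdeal := by ext a; exact hf0 a
  -- The residue of a fraction `n / d` with `d` outside `v` is that of `n * e`, where `e` inverts
  -- `d` modulo the maximal ideal `v`.
  have hsurj : Function.Surjective f := by
    intro z
    obtain ⟨x, rfl⟩ := IsLocalRing.residue_surjective z
    obtain ⟨n, ⟨d, hd⟩, hnd⟩ := v.exists_primeCompl_mul_eq_of_integer (x : F)
      ((mem_ofPrime_ring (K := K) v (x : F)).1 x.2)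
    have hnd' : IsLocalRing.residue P.ring x * f d = f n := by
      change IsLocalRing.residue P.ring x * IsLocalRing.residue P.ring _ =
        IsLocalRing.residue P.ring _
      rw [← map_mul]
      exact congrArg _ (Subtype.ext hnd)
    have : v.asIdeal.IsMaximal := v.isMaximal
    obtain ⟨e, he⟩ := (Ideal.Quotient.maximal_ideal_iff_isField_quotient _).1 this |>.mul_inv_cancel
      (a := Ideal.Quotient.mk v.asIdeal d) (fun h0 => hd (Ideal.Quotient.eq_zero_iff_mem.1 h0))
    obtain ⟨e, rfl⟩ := Ideal.Quotient.mk_surjective e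
    have he' : f (d * e - 1) = 0 := by
      rw [hf0, ← Ideal.Quotient.eq_zero_iff_mem, map_sub, map_mul, he, map_one, sub_self]
    rw [map_sub, map_mul, map_one, sub_eq_zero] at he'
    exact ⟨n * e, by rw [map_mul, ← hnd', mul_assoc, he', mul_one]⟩
  have e := (Ideal.quotientKerAlgEquivOfSurjective hsurj).toLinearEquiv.finrank_eq
  rw [degree, ← e]
  exact (Ideal.quotientEquivAlgOfEq K hker).toLinearEquiv.finrank_eq

end

end FunctionFieldDivisor.Place

/-! ### The place at infinity and the classification of places -/

namespace WeierstrassCurve.Affine.CoordinateRing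

section
variable {K : Type*} [Field K] (W : WeierstrassCurve.Affine K)

theorem deg_mul {a b : W.CoordinateRing} (ha : a ≠ 0) (hb : b ≠ 0) :
    deg W (a * b) = deg W a + deg W b := by
  rw [deg, map_mul, natDegree_mul]
  · rfl
  · exact Algebra.norm_ne_zero_iff.2 ha
  · exact Algebra.norm_ne_zero_iff.2 hb

/-- The contributions `2 deg p` and `2 deg q + 3` have opposite parities, so the two terms cannot
cancel at infinity. -/
theorem deg_le_iff (p q : K[X]) (n : ℕ) : deg W (ofX W p + ofX W q * coordY W) ≤ n ↔
    (p ≠ 0 → 2 * p.natDegree ≤ n) ∧ (q ≠ 0 → 2 * q.natDegree + 3 ≤ n) := by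
  rw [deg, ofX_add_eq_smul, natDegree_le_iff_degree_le, degree_norm_smul_basis, max_le_iff]
  refine and_congr ?_ ?_
  · by_cases hp0 : p = 0
    · simp [hp0]
    · simp only [hp0, degree_eq_natDegree hp0, nsmul_eq_mul, ne_eq, not_false_eq_true, true_imp_iff]
      norm_cast
  · by_cases hq0 : q = 0
    · simp [hq0]
    · simp only [hq0, degree_eq_natDegree hq0, nsmul_eq_mul, ne_eq, not_false_eq_true, true_imp_iff]
      norm_cast

theorem deg_ofX {p : K[X]} (hp : p ≠ 0) : deg W (ofX W p) = 2 * p.natDegree := by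
  have h := deg_le_iff W p 0
  simp only [map_zero, zero_mul, add_zero, ne_eq, not_true_eq_false, false_imp_iff, and_true, hp,
    not_false_eq_true, true_imp_iff] at h
  exact le_antisymm ((h _).2 le_rfl) ((h _).1 le_rfl)

theorem deg_ofX_mul_coordY {q : K[X]} (hq : q ≠ 0) :
    deg W (ofX W q * coordY W) = 2 * q.natDegree + 3 := by
  have h := deg_le_iff W 0 q
  simp only [map_zero, zero_add, ne_eq, not_true_eq_false, false_imp_iff, true_and, hq,
    not_false_eq_true, true_imp_iff] at h
  exact le_antisymm ((h _).2 le_rfl) ((h _).1 le_rfl)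

theorem deg_ofX_add {p q : K[X]} (hp : p ≠ 0) (hq : q ≠ 0) :
    deg W (ofX W p + ofX W q * coordY W) = max (2 * p.natDegree) (2 * q.natDegree + 3) := by
  have h := deg_le_iff W p q
  simp only [hp, hq, ne_eq, not_false_eq_true, true_imp_iff, ← max_le_iff] at h
  exact le_antisymm ((h _).2 le_rfl) ((h _).1 le_rfl)

theorem eq_zero_or_deg_lt {p q : K[X]} {n : ℕ} (hp : p ≠ 0 → 2 * p.natDegree < n)
    (hq : q ≠ 0 → 2 * q.natDegree + 3 < n) : ofX W p + ofX W q * coordY W = 0 ∨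
      deg W (ofX W p + ofX W q * coordY W) < n := by
  rcases n.eq_zero_or_pos with rfl | hn
  · left
    have hp0 : p = 0 := by by_contra h; simpa using hp h
    have hq0 : q = 0 := by by_contra h; simpa using hq h
    simp [hp0, hq0]
  · right
    have := (deg_le_iff W p q (n - 1)).2 ⟨fun h => by have := hp h; omega, fun h => by
      have := hq h; omega⟩
    omega

theorem deg_add_le {a b : W.CoordinateRing} {n : ℕ} (ha : deg W a ≤ n) (hb : deg W b ≤ n) :
    deg W (a + b) ≤ n := by
  obtain ⟨p, q, rfl⟩ := exists_eq_ofX_add W a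
  obtain ⟨r, s, rfl⟩ := exists_eq_ofX_add W b
  have key : ∀ {p r : K[X]} {m : ℕ}, (p ≠ 0 → 2 * p.natDegree + m ≤ n) →
      (r ≠ 0 → 2 * r.natDegree + m ≤ n) → (p + r ≠ 0 → 2 * (p + r).natDegree + m ≤ n) := by
    intro p r m hp hr h
    by_cases hp0 : p = 0
    · subst hp0; rw [zero_add] at h ⊢; exact hr h
    by_cases hr0 : r = 0
    · subst hr0; rw [add_zero] at h ⊢; exact hp h
    have h1 := hp hp0
    have h2 := hr hr0
    have h3 := natDegree_add_le p r
    rcases le_max_iff.1 h3 with h4 | h4 <;> omega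
  rw [deg_le_iff] at ha hb
  have : ofX W p + ofX W q * coordY W + (ofX W r + ofX W s * coordY W) =
      ofX W (p + r) + ofX W (q + s) * coordY W := by
    simp only [map_add]; ring
  rw [this, deg_le_iff]
  exact ⟨key (m := 0) ha.1 hb.1, key ha.2 hb.2⟩

/-- The parity of the common degree decides whether the polynomial part or the `Y` part dominates,
and it is the same part in `a` and `b`. The constant is the quotient of the leading coefficients of
these parts. -/
theorem exists_deg_sub_lt {a b : W.CoordinateRing} (ha : a ≠ 0) (hb : b ≠ 0)
    (hab : deg W a = deg W b) :
    ∃ c : K, a - algebraMap K _ c * b = 0 ∨ deg W (a - algebraMap K _ c * b) < deg W b := by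
  obtain ⟨p, q, rfl⟩ := exists_eq_ofX_add W a
  obtain ⟨r, s, rfl⟩ := exists_eq_ofX_add W b
  set n := deg W (ofX W r + ofX W s * coordY W) with hn
  have hsub : ∀ c : K, ofX W p + ofX W q * coordY W -
      algebraMap K _ c * (ofX W r + ofX W s * coordY W) =
      ofX W (p - C c * r) + ofX W (q - C c * s) * coordY W := fun c => by
    simp only [map_sub, map_mul, ← ofX_C]; ring
  have h1 := (deg_le_iff W p q n).1 hab.le
  have h2 := (deg_le_iff W r s n).1 hn.symm.le
  have hlead : ∀ {p r : K[X]}, p ≠ 0 → r ≠ 0 → p.natDegree = r.natDegree →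
      p - C (p.leadingCoeff / r.leadingCoeff) * r ≠ 0 →
      (p - C (p.leadingCoeff / r.leadingCoeff) * r).natDegree < p.natDegree := by
    intro p r hp hr hpr h
    have hlr := leadingCoeff_ne_zero.2 hr
    have hlp := leadingCoeff_ne_zero.2 hp
    refine natDegree_lt_natDegree h (degree_sub_lt_left ?_ hp ?_)
    · rw [degree_C_mul (div_ne_zero hlp hlr), degree_eq_natDegree hp, degree_eq_natDegree hr, hpr]
    · rw [leadingCoeff_mul, leadingCoeff_C, div_mul_cancel₀ _ hlr]
  have hle : ∀ {p r : K[X]} {c : K} {m : ℕ}, (p ≠ 0 → 2 * p.natDegree + m ≤ n) →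
      (r ≠ 0 → 2 * r.natDegree + m ≤ n) → (p - C c * r ≠ 0 → 2 * (p - C c * r).natDegree + m ≤ n) := by
    intro p r c m hp hr h
    by_cases hp0 : p = 0
    · subst hp0
      rw [zero_sub, natDegree_neg] at *
      have hr0 : r ≠ 0 := by rintro rfl; simp at h
      have := natDegree_C_mul_le c r
      have := hr hr0
      omega
    by_cases hr0 : r = 0
    · subst hr0
      simp only [mul_zero, sub_zero] at *
      exact hp hp0
    have h1 := hp hp0
    have h2 := hr hr0
    have h3 := natDegree_sub_le p (C c * r)
    have h4 := natDegree_C_mul_le c r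
    rcases le_max_iff.1 h3 with h5 | h5 <;> omega
  have hmax : ∀ {p q : K[X]}, ofX W p + ofX W q * coordY W ≠ 0 →
      deg W (ofX W p + ofX W q * coordY W) = n →
      (p ≠ 0 ∧ 2 * p.natDegree = n) ∨ (q ≠ 0 ∧ 2 * q.natDegree + 3 = n) := by
    intro p q h0 h
    by_contra! hcon
    have h1 := (deg_le_iff W p q n).1 h.le
    rcases eq_zero_or_deg_lt W (p := p) (q := q) (n := n)
      (fun h => lt_of_le_of_ne (h1.1 h) (hcon.1 h))
      (fun h => lt_of_le_of_ne (h1.2 h) (hcon.2 h)) with h | h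
    · exact h0 h
    · omega
  rcases hmax ha hab with ⟨hp, hpn⟩ | ⟨hq, hqn⟩
  · rcases hmax hb hn.symm with ⟨hr, hrn⟩ | ⟨hs, hsn⟩
    swap
    · omega
    refine ⟨p.leadingCoeff / r.leadingCoeff, ?_⟩
    rw [hsub]
    refine eq_zero_or_deg_lt W (fun h => ?_) (fun h => ?_)
    · have := hlead hp hr (by omega) h
      omega
    · have := hle (m := 3) h1.2 h2.2 h
      omega
  · rcases hmax hb hn.symm with ⟨hr, hrn⟩ | ⟨hs, hsn⟩
    · omega
    refine ⟨q.leadingCoeff / s.leadingCoeff, ?_⟩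
    rw [hsub]
    refine eq_zero_or_deg_lt W (fun h => ?_) (fun h => ?_)
    · have := hle (m := 0) h1.1 h2.1 h
      omega
    · have := hlead hq hs (by omega) h
      omega

open Classical in
/-- The valuation of the coordinate ring given by the pole order at infinity. -/
noncomputable def degValuation : Valuation W.CoordinateRing (WithZero (Multiplicative ℤ)) where
  toFun a := if a = 0 then 0 else WithZero.exp (deg W a : ℤ)
  map_zero' := if_pos rfl
  map_one' := by
    rw [if_neg one_ne_zero, deg, map_one, natDegree_one]; rfl
  map_mul' a b := by
    by_cases ha : a = 0
    · simp [ha]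
    by_cases hb : b = 0
    · simp [hb]
    rw [if_neg ha, if_neg hb, if_neg (mul_ne_zero ha hb), deg_mul W ha hb, Nat.cast_add,
      WithZero.exp_add]
  map_add_le_max' a b := by
    by_cases ha : a = 0
    · simp [ha]
    by_cases hb : b = 0
    · simp [hb]
    by_cases hab : a + b = 0
    · simp [hab]
    rw [if_neg ha, if_neg hb, if_neg hab, le_max_iff, WithZero.exp_le_exp, WithZero.exp_le_exp,
      Nat.cast_le, Nat.cast_le, ← le_max_iff]
    exact deg_add_le W (le_max_left _ _) (le_max_right _ _)

theorem degValuation_apply {a : W.CoordinateRing} (ha : a ≠ 0) :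
    degValuation W a = WithZero.exp (deg W a : ℤ) := if_neg ha

theorem degValuation_support_le :
    nonZeroDivisors W.CoordinateRing ≤ (degValuation W).supp.primeCompl := by
  intro a ha h
  have ha0 := nonZeroDivisors.ne_zero ha
  have : degValuation W a = 0 := h
  rw [degValuation_apply W ha0] at this
  exact WithZero.exp_ne_zero this

theorem deg_algebraMap (c : K) : deg W (algebraMap K _ c) = 0 := by
  by_cases hc : c = 0
  · rw [hc, map_zero, deg, Algebra.norm_zero, natDegree_zero]
  · rw [← ofX_C, deg_ofX W (C_ne_zero.2 hc), natDegree_C]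

theorem ofX_X_ne_zero : ofX W X ≠ 0 := (map_ne_zero_iff _ (ofX_injective W)).2 X_ne_zero

theorem coordY_ne_zero : coordY W ≠ 0 := fun h => by
  have := (ofX_add_eq_zero W (p := 0) (q := 1) (by simpa using h)).2
  exact one_ne_zero this

theorem deg_X : deg W (ofX W X) = 2 := by rw [deg_ofX W X_ne_zero, natDegree_X]

theorem deg_coordY : deg W (coordY W) = 3 := by
  have := deg_ofX_mul_coordY W (q := 1) one_ne_zero
  simpa using this

open FunctionFieldDivisor

/-- The place at infinity of a Weierstrass curve. -/
noncomputable def infty : Place K W.FunctionField :=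
  Place.ofValuation ((degValuation W).extendToLocalization (degValuation_support_le W)
      W.FunctionField)
    (fun c => by
      rw [IsScalarTower.algebraMap_apply K W.CoordinateRing,
        Valuation.extendToLocalization_apply_map_apply]
      by_cases hc : algebraMap K W.CoordinateRing c = 0
      · simp [hc]
      · rw [degValuation_apply W hc, deg_algebraMap]; rfl)
    -- The pole orders of `X` and `Y` are `2` and `3`, so `X / Y` is a uniformizer.
    ⟨algebraMap _ _ (ofX W X) * (algebraMap _ _ (coordY W))⁻¹, by
      rw [map_mul, map_inv₀, Valuation.extendToLocalization_apply_map_apply,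
        Valuation.extendToLocalization_apply_map_apply, degValuation_apply W (ofX_X_ne_zero W),
        degValuation_apply W (coordY_ne_zero W), deg_X, deg_coordY, ← WithZero.exp_neg,
        ← WithZero.exp_add]
      rfl⟩

theorem algebraMap_ne_zero {a : W.CoordinateRing} (ha : a ≠ 0) :
    algebraMap W.CoordinateRing W.FunctionField a ≠ 0 :=
  (map_ne_zero_iff _ (IsFractionRing.injective _ _)).2 ha

theorem ord_infty {a : W.CoordinateRing} (ha : a ≠ 0) :
    (infty W).ord (algebraMap _ W.FunctionField a) = -(deg W a : ℤ) := by
  rw [infty, Place.ord_ofValuation _ _ _ (algebraMap_ne_zero W ha),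
    Valuation.extendToLocalization_apply_map_apply, degValuation_apply W ha, WithZero.log_exp]

theorem exists_eq_div (f : W.FunctionField) : ∃ a b : W.CoordinateRing, b ≠ 0 ∧
    f = algebraMap _ _ a / algebraMap _ _ b := by
  obtain ⟨a, b, hb, rfl⟩ := IsFractionRing.div_surjective W.CoordinateRing f
  exact ⟨a, b, nonZeroDivisors.ne_zero hb, rfl⟩

/-- In a quotient `a / b` of order zero, `a` and `b` have equal pole orders, so subtracting a
constant multiple of `b` from `a` lowers the pole order. That constant is the value of `a / b` at
infinity. -/
theorem degree_infty : (infty W).degree = 1 := by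
  apply Place.degree_eq_one
  intro f hf hf0
  obtain ⟨a, b, hb, rfl⟩ := exists_eq_div W f
  have ha : a ≠ 0 := by rintro rfl; simp at hf
  have hb' := algebraMap_ne_zero W hb
  rw [div_eq_mul_inv, Place.ord_mul _ (algebraMap_ne_zero W ha) (inv_ne_zero hb'), Place.ord_inv,
    ord_infty W ha, ord_infty W hb] at hf0
  obtain ⟨c, hc⟩ := exists_deg_sub_lt W ha hb (by omega)
  have hsub : algebraMap _ W.FunctionField a / algebraMap _ _ b - algebraMap K _ c =
      algebraMap _ _ (a - algebraMap K _ c * b) * (algebraMap _ _ b)⁻¹ := by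
    rw [map_sub, map_mul, ← IsScalarTower.algebraMap_apply]
    field_simp
  refine ⟨c, ?_⟩
  rw [hsub]
  by_cases h0 : a - algebraMap K _ c * b = 0
  · left
    rw [h0, map_zero, zero_mul, sub_eq_zero] at hsub
    exact hsub
  · right
    have := hc.resolve_left h0
    rw [Place.ord_mul _ (algebraMap_ne_zero W h0) (inv_ne_zero hb'), Place.ord_inv,
      ord_infty W h0, ord_infty W hb]
    omega

/-- The order of a polynomial in `X` at a pole of `X`. -/
theorem ord_ofX_of_ord_X_neg (P : Place K W.FunctionField)
    (hX : P.ord (algebraMap _ _ (ofX W X)) < 0) {p : K[X]} (hp : p ≠ 0) :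
    P.ord (algebraMap _ _ (ofX W p)) = p.natDegree * P.ord (algebraMap _ _ (ofX W X)) := by
  induction hn : p.natDegree generalizing p with
  | zero =>
    obtain ⟨c, rfl⟩ := natDegree_eq_zero.1 hn
    rw [ofX_C, ← IsScalarTower.algebraMap_apply, Place.ord_algebraMap_const _ (C_ne_zero.1 hp)]
    simp
  | succ n ih =>
    -- In `p = divX p * X + p(0)` the first summand has negative order and the constant has order
    -- zero or vanishes, so the first summand determines the order.
    have hd : p.divX.natDegree = n := by rw [natDegree_divX_eq_natDegree_tsub_one, hn]; rfl
    have hd0 : p.divX ≠ 0 := by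
      intro h
      rw [divX_eq_zero_iff] at h
      rw [h, natDegree_C] at hn
      omega
    have h1 := ih hd0 hd
    have hne := algebraMap_ne_zero W ((map_ne_zero_iff _ (ofX_injective W)).2 hd0)
    have hXne := algebraMap_ne_zero W (ofX_X_ne_zero W)
    have h2 : P.ord (algebraMap _ W.FunctionField (ofX W (p.divX * X))) =
        (n + 1 : ℕ) * P.ord (algebraMap _ _ (ofX W X)) := by
      rw [map_mul, map_mul, Place.ord_mul _ hne hXne, h1]
      push_cast; ring
    have h2ne : algebraMap _ W.FunctionField (ofX W (p.divX * X)) ≠ 0 :=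
      algebraMap_ne_zero W ((map_ne_zero_iff _ (ofX_injective W)).2 (mul_ne_zero hd0 X_ne_zero))
    rw [← h2, ← divX_mul_X_add p]
    simp only [divX_mul_X_add]
    nth_rw 1 [← divX_mul_X_add p]
    by_cases hc : p.coeff 0 = 0
    · rw [hc, C_0, add_zero]
    · rw [map_add, map_add]
      refine (P.ord_add_eq_of_lt h2ne ?_ ?_).2
      · exact algebraMap_ne_zero W ((map_ne_zero_iff _ (ofX_injective W)).2 (C_ne_zero.2 hc))
      · rw [ofX_C, ← IsScalarTower.algebraMap_apply, Place.ord_algebraMap_const _ hc, h2]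
        exact mul_neg_of_pos_of_neg (by positivity) hX

theorem natDegree_linPoly_le : (linPoly W).natDegree ≤ 1 := natDegree_linear_le

theorem natDegree_cubPoly : (cubPoly W).natDegree = 3 := by
  have := natDegree_cubic (a := (1 : K)) (b := W.a₂) (c := W.a₄) (d := W.a₆) one_ne_zero
  rwa [C_1, one_mul] at this

theorem cubPoly_ne_zero : cubPoly W ≠ 0 := by
  intro h
  have := natDegree_cubPoly W
  rw [h, natDegree_zero] at this
  omega

/-- Let `m < 0` be the order of `X`. In `Y (Y + b) = X³ + ⋯` the right side has order `3m`, and the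
linear polynomial `b` in `X` has order at least `m` if it is nonzero. If `Y` had order at least `m`,
the left side would have order at least `2m > 3m`. So `Y` dominates `b`, and both factors have the
same order. -/
theorem two_mul_ord_coordY (P : Place K W.FunctionField)
    (hX : P.ord (algebraMap _ _ (ofX W X)) < 0) :
    2 * P.ord (algebraMap _ _ (coordY W)) = 3 * P.ord (algebraMap _ _ (ofX W X)) := by
  set y := algebraMap W.CoordinateRing W.FunctionField (coordY W) with hy
  set b := algebraMap W.CoordinateRing W.FunctionField (ofX W (linPoly W)) with hb
  set m := P.ord (algebraMap _ _ (ofX W X)) with hm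
  have hc : P.ord (algebraMap _ _ (ofX W (cubPoly W))) = 3 * m := by
    rw [ord_ofX_of_ord_X_neg W P hX (cubPoly_ne_zero W), natDegree_cubPoly]; rfl
  have hcne := algebraMap_ne_zero W ((map_ne_zero_iff _ (ofX_injective W)).2 (cubPoly_ne_zero W))
  have hrel : y * (y + b) = algebraMap _ _ (ofX W (cubPoly W)) := by
    rw [hy, hb, ← map_add, ← map_mul]
    congr 1
    linear_combination coordY_sq W
  have hyne : y ≠ 0 := algebraMap_ne_zero W (coordY_ne_zero W)
  have hybne : y + b ≠ 0 := by
    intro h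
    rw [h, mul_zero] at hrel
    exact hcne hrel.symm
  have hord : P.ord y + P.ord (y + b) = 3 * m := by
    rw [← P.ord_mul hyne hybne, hrel, hc]
  have hbm : b ≠ 0 → m ≤ P.ord b := fun hb0 => by
    have hl : linPoly W ≠ 0 := by
      intro h
      rw [hb, h, map_zero, map_zero] at hb0
      exact hb0 rfl
    rw [hb, ord_ofX_of_ord_X_neg W P hX hl, ← hm]
    rcases Nat.le_one_iff_eq_zero_or_eq_one.1 (natDegree_linPoly_le W) with h | h <;> rw [h]
    · simpa using hX.le
    · simp
  by_cases hlt : P.ord y < m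
  · have : P.ord (y + b) = P.ord y := by
      by_cases hb0 : b = 0
      · rw [hb0, add_zero]
      · exact (P.ord_add_eq_of_lt hyne hb0 (hlt.trans_le (hbm hb0))).2
    omega
  · have := P.le_ord_add hybne (fun _ => not_lt.1 hlt) hbm
    omega

/-- With `k = ord X - ord Y` the orders of `X` and `Y` are `-2k` and `-3k`. By parity `p` and `qY`
never have the same order, so the order at `P` is `k` times the order at infinity. -/
theorem ord_eq_of_ord_X_neg (P : Place K W.FunctionField)
    (hX : P.ord (algebraMap _ _ (ofX W X)) < 0) : ∃ k : ℤ, 0 < k ∧ ∀ a : W.CoordinateRing, a ≠ 0 →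
      P.ord (algebraMap _ _ a) = -(k * deg W a) := by
  have h2 := two_mul_ord_coordY W P hX
  refine ⟨P.ord (algebraMap _ _ (ofX W X)) - P.ord (algebraMap _ _ (coordY W)), by omega, ?_⟩
  set k := P.ord (algebraMap _ _ (ofX W X)) - P.ord (algebraMap _ _ (coordY W)) with hk
  have hXk : P.ord (algebraMap _ _ (ofX W X)) = -(2 * k) := by omega
  have hYk : P.ord (algebraMap _ _ (coordY W)) = -(3 * k) := by omega
  have hk0 : 0 < k := by omega
  intro a ha
  obtain ⟨p, q, rfl⟩ := exists_eq_ofX_add W a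
  have hp : p ≠ 0 → P.ord (algebraMap _ _ (ofX W p)) = -(k * (2 * p.natDegree : ℕ)) := fun h => by
    rw [ord_ofX_of_ord_X_neg W P hX h, hXk]; push_cast; ring
  have hq : q ≠ 0 → P.ord (algebraMap _ _ (ofX W q * coordY W)) =
      -(k * (2 * q.natDegree + 3 : ℕ)) := fun h => by
    rw [map_mul, P.ord_mul (algebraMap_ne_zero W ((map_ne_zero_iff _ (ofX_injective W)).2 h))
      (algebraMap_ne_zero W (coordY_ne_zero W)), ord_ofX_of_ord_X_neg W P hX h, hXk, hYk]
    push_cast; ring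
  by_cases hp0 : p = 0
  · have hq0 : q ≠ 0 := by rintro rfl; simp [hp0] at ha
    rw [hp0, map_zero, zero_add, deg_ofX_mul_coordY W hq0, hq hq0]
  by_cases hq0 : q = 0
  · rw [hq0, map_zero, zero_mul, add_zero, deg_ofX W hp0, hp hp0]
  have hpne := algebraMap_ne_zero W ((map_ne_zero_iff _ (ofX_injective W)).2 hp0)
  have hqne := algebraMap_ne_zero W (mul_ne_zero
    ((map_ne_zero_iff _ (ofX_injective W)).2 hq0) (coordY_ne_zero W))
  rw [deg_ofX_add W hp0 hq0, map_add]
  rcases lt_or_gt_of_ne (show 2 * p.natDegree ≠ 2 * q.natDegree + 3 by omega) with h | h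
  · rw [max_eq_right h.le, add_comm, (P.ord_add_eq_of_lt hqne hpne _).2, hq hq0]
    rw [hp hp0, hq hq0, neg_lt_neg_iff, mul_lt_mul_iff_right₀ hk0]
    exact_mod_cast h
  · rw [max_eq_left h.le, (P.ord_add_eq_of_lt hpne hqne _).2, hp hp0]
    rw [hp hp0, hq hq0, neg_lt_neg_iff, mul_lt_mul_iff_right₀ hk0]
    exact_mod_cast h

/-- The place at infinity is the only pole of `X`. -/
theorem eq_infty_of_ord_X_neg (P : Place K W.FunctionField)
    (hX : P.ord (algebraMap _ _ (ofX W X)) < 0) : P = infty W := by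
  obtain ⟨k, hk, h⟩ := ord_eq_of_ord_X_neg W P hX
  refine Place.eq_of_ord fun f hf => ?_
  obtain ⟨a, b, hb, rfl⟩ := exists_eq_div W f
  have ha : a ≠ 0 := by rintro rfl; simp at hf
  have hb' := algebraMap_ne_zero W hb
  have ha' := algebraMap_ne_zero W ha
  rw [div_eq_mul_inv, Place.ord_mul _ ha' (inv_ne_zero hb'), Place.ord_inv,
    Place.ord_mul _ ha' (inv_ne_zero hb'), Place.ord_inv,
    ord_infty W ha, ord_infty W hb, h a ha, h b hb]
  have : -(k * (deg W a : ℤ)) + - -(k * (deg W b : ℤ)) = k * (-(deg W a : ℤ) + - -(deg W b : ℤ)) := by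
    ring
  rw [this, mul_nonneg_iff_of_pos_left hk]

theorem ord_infty_X : (infty W).ord (algebraMap _ _ (ofX W X)) = -2 := by
  rw [ord_infty W (ofX_X_ne_zero W), deg_X]; rfl

open IsDedekindDomain

/-- The places of an elliptic curve are the maximal ideals of the coordinate ring and infinity. -/
theorem eq_infty_or_exists_eq_ofPrime [W.IsElliptic] (P : Place K W.FunctionField) :
    P = infty W ∨ ∃ v : HeightOneSpectrum W.CoordinateRing, P = Place.ofPrime K W.FunctionField v := by
  rcases lt_or_ge (P.ord (algebraMap _ _ (ofX W X))) 0 with h | h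
  · exact Or.inl (eq_infty_of_ord_X_neg W P h)
  right
  apply Place.exists_eq_ofPrime
  -- If `X` has no pole at `P`, then `K[X]` is regular at `P`, and so is the coordinate ring, which
  -- is integral over it.
  rw [← P.mem_ring_iff (algebraMap_ne_zero W (ofX_X_ne_zero W))] at h
  have hp : ∀ p : K[X], algebraMap _ W.FunctionField (ofX W p) ∈ P.ring := by
    intro p
    induction p using Polynomial.induction_on' with
    | add p q hp hq => rw [map_add, map_add]; exact P.ring.add_mem _ _ hp hq
    | monomial n c =>
      rw [← C_mul_X_pow_eq_monomial, map_mul, map_mul, map_pow, map_pow, ofX_C,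
        ← IsScalarTower.algebraMap_apply]
      exact P.ring.mul_mem _ _ (P.algebraMap_mem c) (pow_mem h n)
  intro a
  have hint : _root_.IsIntegral K[X] a := Algebra.IsIntegral.isIntegral a
  obtain ⟨r, hr, hr'⟩ := hint
  have h2 : _root_.IsIntegral P.ring (algebraMap _ W.FunctionField a) := by
    refine ⟨r.map (((algebraMap _ W.FunctionField).comp (ofX W)).codRestrict P.ring hp),
      hr.map _, ?_⟩
    rw [eval₂_map]
    have := congrArg (algebraMap _ W.FunctionField) hr'
    rw [hom_eval₂, map_zero] at this
    exact this
  obtain ⟨y, hy⟩ := IsIntegrallyClosed.isIntegral_iff.1 h2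
  rw [← hy]
  exact y.2

theorem ofPrime_ne_infty [W.IsElliptic] (v : HeightOneSpectrum W.CoordinateRing) :
    Place.ofPrime K W.FunctionField v ≠ infty W := by
  intro h
  have h1 := Place.ord_ofPrime_nonneg (K := K) (F := W.FunctionField) v (ofX_X_ne_zero W)
  rw [h, ord_infty_X] at h1
  omega

end

end WeierstrassCurve.Affine.CoordinateRing

/-! ### Degrees of divisors and their affine ideals -/

namespace WeierstrassCurve.Affine.CoordinateRing

open FunctionFieldDivisor IsDedekindDomain nonZeroDivisors

section
variable {K : Type*} [Field K] (W : WeierstrassCurve.Affine K)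

theorem coeIdeal_ne_zero' {I : Ideal W.CoordinateRing} (hI : I ≠ ⊥) :
    (I : FractionalIdeal W.CoordinateRing⁰ W.FunctionField) ≠ 0 :=
  FractionalIdeal.coeIdeal_ne_zero.2 hI

theorem degree_single (P : Place K W.FunctionField) (n : ℤ) :
    Divisor.degree (Finsupp.single P n) = n * P.degree := by
  rw [Divisor.degree, Finsupp.liftAddHom_apply_single]; rfl

variable [W.IsElliptic]

theorem count_spanSingleton (v : HeightOneSpectrum W.CoordinateRing) {f : W.FunctionField}
    (hf : f ≠ 0) : FractionalIdeal.count W.FunctionField v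
      (FractionalIdeal.spanSingleton W.CoordinateRing⁰ f) =
        (Place.ofPrime K W.FunctionField v).ord f := by
  classical
  have key : ∀ a : W.CoordinateRing, a ≠ 0 → FractionalIdeal.count W.FunctionField v
      (FractionalIdeal.spanSingleton W.CoordinateRing⁰ (algebraMap _ W.FunctionField a)) =
        (Place.ofPrime K W.FunctionField v).ord (algebraMap _ _ a) := by
    intro a ha
    rw [Place.ord_ofPrime v (algebraMap_ne_zero W ha), v.valuation_of_algebraMap,
      v.intValuation_if_neg ha, WithZero.log_exp, neg_neg,
      ← FractionalIdeal.coeIdeal_span_singleton, FractionalIdeal.count_coe]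
    simpa using ha
  obtain ⟨a, b, hb, rfl⟩ := exists_eq_div W f
  have ha : a ≠ 0 := by rintro rfl; simp at hf
  have ha' := algebraMap_ne_zero W ha
  have hb' := algebraMap_ne_zero W hb
  rw [div_eq_mul_inv, ← FractionalIdeal.spanSingleton_mul_spanSingleton,
    ← FractionalIdeal.spanSingleton_inv, FractionalIdeal.count_mul, FractionalIdeal.count_inv,
    Place.ord_mul _ ha' (inv_ne_zero hb'), Place.ord_inv, key a ha, key b hb]
  · exact FractionalIdeal.spanSingleton_ne_zero_iff.2 ha'
  · exact inv_ne_zero (FractionalIdeal.spanSingleton_ne_zero_iff.2 hb')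

theorem eq_of_count_eq {I J : FractionalIdeal W.CoordinateRing⁰ W.FunctionField} (hI : I ≠ 0)
    (hJ : J ≠ 0) (h : ∀ v : HeightOneSpectrum W.CoordinateRing,
      FractionalIdeal.count W.FunctionField v I = FractionalIdeal.count W.FunctionField v J) :
    I = J := by
  rw [← FractionalIdeal.finprod_heightOneSpectrum_factorization' W.FunctionField hI,
    ← FractionalIdeal.finprod_heightOneSpectrum_factorization' W.FunctionField hJ]
  simp only [h]

theorem single_ofPrime_apply (v w : HeightOneSpectrum W.CoordinateRing) (n : ℤ) [Decidable (w = v)] :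
    (Finsupp.single (Place.ofPrime K W.FunctionField w) n : Divisor K W.FunctionField)
      (Place.ofPrime K W.FunctionField v) = if w = v then n else 0 := by
  classical
  rw [Finsupp.single_apply]
  simp only [Place.ofPrime_injective.eq_iff]

theorem degree_eq_of_affine_eq_zero (D : Divisor K W.FunctionField)
    (h : ∀ v : HeightOneSpectrum W.CoordinateRing, D (Place.ofPrime K W.FunctionField v) = 0) :
    Divisor.degree D = D (infty W) := by
  have hD : D = Finsupp.single (infty W) (D (infty W)) := by
    ext P
    rcases eq_infty_or_exists_eq_ofPrime W P with rfl | ⟨v, rfl⟩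
    · rw [Finsupp.single_eq_same]
    · rw [h, Finsupp.single_eq_of_ne]
      exact ofPrime_ne_infty W v
  conv_lhs => rw [hD]
  rw [degree_single, degree_infty]; simp

theorem degree_add_single_ofPrime (D : Divisor K W.FunctionField)
    (v : HeightOneSpectrum W.CoordinateRing) (n : ℤ) :
    Divisor.degree (D + Finsupp.single (Place.ofPrime K W.FunctionField v) n) =
      Divisor.degree D + n * Module.finrank K (W.CoordinateRing ⧸ v.asIdeal) ∧
    (D + Finsupp.single (Place.ofPrime K W.FunctionField v) n) (infty W) = D (infty W) := by
  constructor
  · rw [map_add, degree_single, Place.degree_ofPrime]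
  · rw [Finsupp.add_apply, Finsupp.single_eq_of_ne (ofPrime_ne_infty W v).symm, add_zero]

/-- By induction on the prime factors of `I`: a prime factor contributes its residue degree to the
degree of the divisor and, by additivity, to the colength of `I`. -/
theorem degree_eq_of_count_eq {I : Ideal W.CoordinateRing} (hI : I ≠ ⊥)
    (D : Divisor K W.FunctionField)
    (h : ∀ v : HeightOneSpectrum W.CoordinateRing, D (Place.ofPrime K W.FunctionField v) =
      FractionalIdeal.count W.FunctionField v I) :
    Divisor.degree D = D (infty W) + Module.finrank K (W.CoordinateRing ⧸ I) := by
  classical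
  induction I using UniqueFactorizationMonoid.induction_on_prime generalizing D with
  | h₁ => exact absurd rfl hI
  | h₂ I hu =>
    rw [Ideal.isUnit_iff] at hu
    subst hu
    rw [degree_eq_of_affine_eq_zero W D fun v => by
      rw [h, FractionalIdeal.coeIdeal_top, FractionalIdeal.count_one],
      Module.finrank_zero_of_subsingleton, Nat.cast_zero, add_zero]
  | h₃ J P hJ0 hP ih =>
    let w : HeightOneSpectrum W.CoordinateRing := ⟨P, Ideal.isPrime_of_prime hP, hP.ne_zero⟩
    obtain ⟨h1, h2⟩ := degree_add_single_ofPrime W D w (-1)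
    have := ih hJ0 (D + Finsupp.single (Place.ofPrime K W.FunctionField w) (-1)) (fun v => by
      rw [Finsupp.add_apply, single_ofPrime_apply, h, FractionalIdeal.coeIdeal_mul,
        FractionalIdeal.count_mul _ _ (coeIdeal_ne_zero' W hP.ne_zero) (coeIdeal_ne_zero' W hJ0)]
      have := FractionalIdeal.count_maximal W.FunctionField v w
      change FractionalIdeal.count W.FunctionField v (P : FractionalIdeal _ _) = _ at this
      rw [this]
      split_ifs <;> ring)
    rw [h1, h2] at this
    rw [finrank_quotient_mul W hP.ne_zero hJ0]
    push_cast
    change _ = _ + ((Module.finrank K (W.CoordinateRing ⧸ w.asIdeal) : ℤ) + _)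
    linarith

theorem degree_eq_of_count_sub_eq {I J : Ideal W.CoordinateRing} (hI : I ≠ ⊥) (hJ : J ≠ ⊥)
    (D : Divisor K W.FunctionField)
    (h : ∀ v : HeightOneSpectrum W.CoordinateRing, D (Place.ofPrime K W.FunctionField v) =
      FractionalIdeal.count W.FunctionField v I - FractionalIdeal.count W.FunctionField v J) :
    Divisor.degree D = D (infty W) + Module.finrank K (W.CoordinateRing ⧸ I) -
      Module.finrank K (W.CoordinateRing ⧸ J) := by
  classical
  induction J using UniqueFactorizationMonoid.induction_on_prime generalizing D with
  | h₁ => exact absurd rfl hJ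
  | h₂ J hu =>
    rw [Ideal.isUnit_iff] at hu
    subst hu
    rw [degree_eq_of_count_eq W hI D fun v => by
      rw [h, FractionalIdeal.coeIdeal_top, FractionalIdeal.count_one, sub_zero],
      Module.finrank_zero_of_subsingleton (M := W.CoordinateRing ⧸ (⊤ : Ideal W.CoordinateRing)),
      Nat.cast_zero, sub_zero]
  | h₃ J P hJ0 hP ih =>
    let w : HeightOneSpectrum W.CoordinateRing := ⟨P, Ideal.isPrime_of_prime hP, hP.ne_zero⟩
    obtain ⟨h1, h2⟩ := degree_add_single_ofPrime W D w 1
    have := ih hJ0 (D + Finsupp.single (Place.ofPrime K W.FunctionField w) 1) (fun v => by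
      rw [Finsupp.add_apply, single_ofPrime_apply, h, FractionalIdeal.coeIdeal_mul,
        FractionalIdeal.count_mul _ _ (coeIdeal_ne_zero' W hP.ne_zero) (coeIdeal_ne_zero' W hJ0)]
      have := FractionalIdeal.count_maximal W.FunctionField v w
      change FractionalIdeal.count W.FunctionField v (P : FractionalIdeal _ _) = _ at this
      rw [this]
      split_ifs <;> ring)
    rw [h1, h2] at this
    rw [finrank_quotient_mul W hP.ne_zero hJ0]
    push_cast
    change _ = _ - ((Module.finrank K (W.CoordinateRing ⧸ w.asIdeal) : ℤ) + _)
    linarith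

/-- The degree of a divisor whose affine part is principal. -/
theorem degree_eq_of_ord_eq (D : Divisor K W.FunctionField) {f : W.FunctionField} (hf : f ≠ 0)
    (h : ∀ v : HeightOneSpectrum W.CoordinateRing, D (Place.ofPrime K W.FunctionField v) =
      (Place.ofPrime K W.FunctionField v).ord f) :
    Divisor.degree D = D (infty W) - (infty W).ord f := by
  obtain ⟨a, b, hb, rfl⟩ := exists_eq_div W f
  have ha : a ≠ 0 := by rintro rfl; simp at hf
  have ha' := algebraMap_ne_zero W ha
  have hb' := algebraMap_ne_zero W hb
  have hsa : Ideal.span {a} ≠ ⊥ := by simpa using ha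
  have hsb : Ideal.span {b} ≠ ⊥ := by simpa using hb
  -- The colengths of `(a)` and `(b)` are the pole orders of `a` and `b` at infinity, so the affine
  -- part of the divisor of `a / b` has degree minus the order of `a / b` at infinity.
  rw [degree_eq_of_count_sub_eq W hsa hsb D fun v => by
    rw [h, div_eq_mul_inv, Place.ord_mul _ ha' (inv_ne_zero hb'), Place.ord_inv,
      FractionalIdeal.coeIdeal_span_singleton, FractionalIdeal.coeIdeal_span_singleton,
      count_spanSingleton W v ha', count_spanSingleton W v hb', sub_eq_add_neg],
    finrank_quotient_span_singleton W ha, finrank_quotient_span_singleton W hb, div_eq_mul_inv,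
    Place.ord_mul _ ha' (inv_ne_zero hb'), Place.ord_inv, ord_infty W ha, ord_infty W hb]
  ring

/-- The fractional ideal of the affine part of a divisor. -/
noncomputable def affineIdeal (D : Divisor K W.FunctionField) :
    FractionalIdeal W.CoordinateRing⁰ W.FunctionField :=
  (D.comapDomain (Place.ofPrime K W.FunctionField) Place.ofPrime_injective.injOn).prod
    fun (v : HeightOneSpectrum W.CoordinateRing) n => (v.asIdeal : FractionalIdeal W.CoordinateRing⁰ W.FunctionField) ^ n

theorem affineIdeal_ne_zero (D : Divisor K W.FunctionField) : affineIdeal W D ≠ 0 :=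
  Finset.prod_ne_zero_iff.2 fun v _ => zpow_ne_zero _ (FractionalIdeal.coeIdeal_ne_zero.2 v.ne_bot)

theorem count_affineIdeal (D : Divisor K W.FunctionField) (v : HeightOneSpectrum W.CoordinateRing) :
    FractionalIdeal.count W.FunctionField v (affineIdeal W D) =
      D (Place.ofPrime K W.FunctionField v) := by
  rw [affineIdeal, FractionalIdeal.count_finsuppProd, Finsupp.comapDomain_apply]

end
end WeierstrassCurve.Affine.CoordinateRing

/-! ### Rational points and divisor classes of degree zero -/

namespace WeierstrassCurve.Affine.Point
open CoordinateRing FunctionFieldDivisor IsDedekindDomain nonZeroDivisors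

variable {K : Type*} [Field K] {W : WeierstrassCurve.Affine K}

/-- The maximal ideal of a point of the affine curve. -/
noncomputable def prime {x y : K} (h : W.Equation x y) : HeightOneSpectrum W.CoordinateRing :=
  ⟨XYIdeal W x (C y), (isMaximal_XYIdeal W h).isPrime, XYIdeal_ne_bot W x _⟩

/-- The fractional ideal of a point; the point at infinity has the unit ideal. -/
noncomputable def ideal : W.Point → (FractionalIdeal W.CoordinateRing⁰ W.FunctionField)ˣ
  | 0 => 1
  | some _ _ h => XYIdeal' (W := W) h

theorem toClass_eq_mk [DecidableEq K] (Q : W.Point) :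
    (toClass Q).toMul = ClassGroup.mk W.FunctionField Q.ideal := by
  rcases Q with _ | ⟨x, y, h⟩
  · exact (_root_.map_one (ClassGroup.mk (R := W.CoordinateRing) W.FunctionField)).symm
  · rfl

variable [W.IsElliptic]

/-- The place of a rational point. -/
noncomputable def place : W.Point → Place K W.FunctionField
  | 0 => infty W
  | some _ _ h => Place.ofPrime K W.FunctionField (prime h.1)

theorem degree_place (Q : W.Point) : Q.place.degree = 1 := by
  rcases Q with _ | ⟨x, y, h⟩
  · exact degree_infty W
  · exact (Place.degree_ofPrime _).trans (finrank_quotient_XYIdeal W h.1)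

theorem count_ideal (Q : W.Point) (v : HeightOneSpectrum W.CoordinateRing) :
    FractionalIdeal.count W.FunctionField v (Q.ideal : FractionalIdeal W.CoordinateRing⁰ _) =
      (Finsupp.single Q.place 1 : Divisor K W.FunctionField) (Place.ofPrime K W.FunctionField v) := by
  classical
  rcases Q with _ | ⟨x, y, h⟩
  · change FractionalIdeal.count W.FunctionField v 1 = (Finsupp.single (infty W) 1 :
      Divisor K W.FunctionField) (Place.ofPrime K W.FunctionField v)
    rw [FractionalIdeal.count_one, Finsupp.single_eq_of_ne (ofPrime_ne_infty W v)]
  · have := FractionalIdeal.count_maximal W.FunctionField v (prime h.1)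
    change FractionalIdeal.count W.FunctionField v ((prime h.1).asIdeal : FractionalIdeal _ _) =
      (Finsupp.single (Place.ofPrime K W.FunctionField (prime h.1)) 1 :
        Divisor K W.FunctionField) (Place.ofPrime K W.FunctionField v)
    rw [this, single_ofPrime_apply]

/-- The divisor class `[Q] - [O]` of a rational point `Q`. -/
noncomputable def divisorClass (Q : W.Point) : DivisorClassGroup K W.FunctionField :=
  QuotientAddGroup.mk (Finsupp.single Q.place 1 - Finsupp.single (infty W) 1)

theorem divisorClass_mem (Q : W.Point) :
    Q.divisorClass ∈ classGroupZero K W.FunctionField := by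
  refine ⟨_, ?_, rfl⟩
  change Divisor.degree _ = 0
  rw [map_sub, degree_single, degree_single, degree_place, degree_infty, sub_self]

/-- If `[R] - [Q]` is the divisor of `f`, then multiplication by `f` carries the ideal of `Q` to
that of `R`. The ideal classes agree, and `toClass_injective` applies. -/
theorem divisorClass_injective :
    Function.Injective (divisorClass : W.Point → DivisorClassGroup K W.FunctionField) := by
  classical
  intro Q R h
  obtain ⟨f, hf0, hf⟩ := QuotientAddGroup.eq.1 h
  apply toClass_injective
  apply Additive.toMul.injective
  rw [toClass_eq_mk, toClass_eq_mk, ClassGroup.mk_eq_mk]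
  refine ⟨Units.mk0 f hf0, Units.ext ?_⟩
  rw [Units.val_mul, coe_toPrincipalIdeal, Units.val_mk0]
  have hs : FractionalIdeal.spanSingleton W.CoordinateRing⁰ f ≠ 0 :=
    FractionalIdeal.spanSingleton_ne_zero_iff.2 hf0
  refine eq_of_count_eq W (mul_ne_zero Q.ideal.ne_zero hs) R.ideal.ne_zero fun v => ?_
  rw [FractionalIdeal.count_mul _ _ Q.ideal.ne_zero hs, count_ideal, count_ideal,
    count_spanSingleton W v hf0, ← hf]
  simp only [Finsupp.add_apply, Finsupp.neg_apply, Finsupp.sub_apply]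
  ring

/-- The affine ideal of `D` is `f` times the ideal of some point `Q`. Hence `D - [Q] + [O]` agrees
with the divisor of `f` away from infinity, and having degree zero forces agreement at infinity too.
-/
theorem exists_divisorClass_eq {c : DivisorClassGroup K W.FunctionField}
    (hc : c ∈ classGroupZero K W.FunctionField) : ∃ Q : W.Point, Q.divisorClass = c := by
  classical
  obtain ⟨D, hD, rfl⟩ := hc
  replace hD : Divisor.degree D = 0 := hD
  have hI0 := affineIdeal_ne_zero W D
  obtain ⟨Q, hQ⟩ := toClass_surjective
    (Additive.ofMul (ClassGroup.mk W.FunctionField (Units.mk0 _ hI0)))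
  refine ⟨Q, ?_⟩
  have hQ' := congrArg Additive.toMul hQ
  rw [toClass_eq_mk, toMul_ofMul, ClassGroup.mk_eq_mk] at hQ'
  obtain ⟨f, hf⟩ := hQ'
  have hf' := congrArg Units.val hf
  rw [Units.val_mul, coe_toPrincipalIdeal, Units.val_mk0] at hf'
  have hs : FractionalIdeal.spanSingleton W.CoordinateRing⁰ (f : W.FunctionField) ≠ 0 :=
    FractionalIdeal.spanSingleton_ne_zero_iff.2 f.ne_zero
  set E : Divisor K W.FunctionField :=
    -(Finsupp.single Q.place 1 - Finsupp.single (infty W) 1) + D with hE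
  have hEv : ∀ v : HeightOneSpectrum W.CoordinateRing, E (Place.ofPrime K W.FunctionField v) =
      (Place.ofPrime K W.FunctionField v).ord (f : W.FunctionField) := fun v => by
    rw [← count_spanSingleton W v f.ne_zero]
    have h1 := count_affineIdeal W D v
    rw [← hf', FractionalIdeal.count_mul _ _ Q.ideal.ne_zero hs, count_ideal] at h1
    rw [hE]
    simp only [Finsupp.add_apply, Finsupp.neg_apply, Finsupp.sub_apply]
    rw [← h1, Finsupp.single_eq_of_ne (ofPrime_ne_infty W v)]
    ring
  have hdeg := degree_eq_of_ord_eq W E f.ne_zero hEv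
  have hE0 : Divisor.degree E = 0 := by
    rw [hE, map_add, map_neg, map_sub, degree_single, degree_single, degree_place, degree_infty,
      sub_self, _root_.neg_zero, zero_add, hD]
  refine QuotientAddGroup.eq.2 ⟨f, f.ne_zero, fun P => ?_⟩
  rcases eq_infty_or_exists_eq_ofPrime W P with rfl | ⟨v, rfl⟩
  · change E _ = _
    linarith
  · exact hEv v

/-- The rational points of an elliptic curve are in bijection with the divisor classes of degree
zero. -/
noncomputable def equivClassGroupZero : W.Point ≃ classGroupZero K W.FunctionField :=
  Equiv.ofBijective (fun Q => ⟨Q.divisorClass, Q.divisorClass_mem⟩)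
    ⟨fun _ _ h => divisorClass_injective (congrArg Subtype.val h), fun c => by
      obtain ⟨Q, hQ⟩ := exists_divisorClass_eq c.2
      exact ⟨Q, Subtype.ext hQ⟩⟩

end WeierstrassCurve.Affine.Point

/-! ### Pull-back of divisors and base change of points -/

namespace FunctionFieldDivisor
section
universe u v u' v'
variable {K : Type u} {F : Type v} {K' : Type u'} {F' : Type v'} [Field K] [Field F] [Field K']
  [Field F'] [Algebra K F] [Algebra K' F'] [Algebra K K'] [Algebra F F'] [Algebra K F']
  [IsScalarTower K F F'] [IsScalarTower K K' F'] [FiniteDimensional F F'] [Algebra.IsSeparable F F']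

theorem pullback_single {P : Place K F} {P' : Place K' F'}
    (h : ∀ Q : Place K' F', Q.restrict K F = P ↔ Q = P') (he : P'.ramificationIdx K F = 1) (n : ℤ) :
    pullback K F K' F' (Finsupp.single P n) = Finsupp.single P' n := by
  classical
  ext Q
  rw [pullback_apply]
  by_cases hQ : Q = P'
  · rw [(h Q).2 hQ, hQ, he, Finsupp.single_eq_same, Finsupp.single_eq_same, one_mul]
  · rw [Finsupp.single_eq_of_ne hQ, Finsupp.single_eq_of_ne (fun h' => hQ ((h Q).1 h')), mul_zero]

end
end FunctionFieldDivisor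

namespace WeierstrassCurve.Affine.Point
open CoordinateRing FunctionFieldDivisor IsDedekindDomain

section
variable {K : Type*} [Field K] {W : WeierstrassCurve.Affine K} [W.IsElliptic]

/-- This describes the place of a point by two functions that are compatible with base change, so
that restriction of places can be tested on them. -/
theorem ofPrime_prime_iff {x y : K} (h : W.Equation x y) (P : Place K W.FunctionField) :
    P = Place.ofPrime K W.FunctionField (prime h) ↔
      0 < P.ord (algebraMap _ _ (XClass W x)) ∧ 0 < P.ord (algebraMap _ _ (YClass W (C y))) := by
  constructor
  · rintro rfl
    rw [Place.ord_ofPrime_pos_iff _ (XClass_ne_zero x), Place.ord_ofPrime_pos_iff _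
      (YClass_ne_zero _)]
    exact ⟨Ideal.subset_span (by simp), Ideal.subset_span (by simp)⟩
  · rintro ⟨h1, h2⟩
    rcases eq_infty_or_exists_eq_ofPrime W P with rfl | ⟨v, rfl⟩
    · rw [ord_infty W (XClass_ne_zero x)] at h1
      omega
    · rw [Place.ord_ofPrime_pos_iff _ (XClass_ne_zero x)] at h1
      rw [Place.ord_ofPrime_pos_iff _ (YClass_ne_zero _)] at h2
      congr 1
      ext1
      refine ((isMaximal_XYIdeal W h).eq_of_le v.isPrime.ne_top ?_).symm
      rw [XYIdeal, Ideal.span_le]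
      rintro _ (rfl | rfl)
      · exact h1
      · exact h2

/-- One of the coordinates is a uniformizer at a rational point. -/
theorem ord_ofPrime_prime_eq_one {x y : K} (h : W.Equation x y) :
    (Place.ofPrime K W.FunctionField (prime h)).ord (algebraMap _ _ (XClass W x)) = 1 ∨
      (Place.ofPrime K W.FunctionField (prime h)).ord (algebraMap _ _ (YClass W (C y))) = 1 := by
  by_contra! hcon
  obtain ⟨h1, h2⟩ := (ofPrime_prime_iff h _).1 rfl
  set v := prime h with hv
  have key : ∀ a : W.CoordinateRing, a ≠ 0 →
      2 ≤ (Place.ofPrime K W.FunctionField v).ord (algebraMap _ _ a) → a ∈ v.asIdeal ^ 2 := by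
    intro a ha h
    rw [Place.ord_ofPrime v (algebraMap_ne_zero W ha), v.valuation_of_algebraMap] at h
    rw [← v.intValuation_le_pow_iff_mem, ← WithZero.log_le_log (v.intValuation_ne_zero a ha)
      WithZero.exp_ne_zero, WithZero.log_exp]
    push_cast
    omega
  -- Were both orders at least two, the generators of the maximal ideal would lie in its square,
  -- against the existence of a uniformizer.
  have hle : v.asIdeal ≤ v.asIdeal ^ 2 := by
    change XYIdeal W x (C y) ≤ _
    rw [XYIdeal, Ideal.span_le]
    rintro _ (rfl | rfl)
    · exact key _ (XClass_ne_zero x) (by omega)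
    · exact key _ (YClass_ne_zero _) (by omega)
  obtain ⟨π, hπ⟩ := v.intValuation_exists_uniformizer
  have hπv : π ∈ v.asIdeal := by
    rw [← v.intValuation_lt_one_iff_mem, hπ, ← WithZero.exp_zero, WithZero.exp_lt_exp]
    decide
  have := (v.intValuation_le_pow_iff_mem π 2).2 (hle hπv)
  rw [hπ, WithZero.exp_le_exp] at this
  norm_num at this

end

section
universe u u'
variable {K : Type u} (K' : Type u') [Field K] [Field K'] [Algebra K K'] {W : WeierstrassCurve K}

/-- The base change of points to an extension of the base field. -/
def extend : W.toAffine.Point → (W.map (algebraMap K K')).toAffine.Point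
  | 0 => 0
  | some _ _ h => some _ _ ((W.toAffine.map_nonsingular (algebraMap K K').injective ..).2 h)

theorem extend_injective : Function.Injective (extend K' : W.toAffine.Point → _) := by
  rintro (_ | ⟨x, y, h⟩) (_ | ⟨x', y', h'⟩) hPQ
  · rfl
  · cases hPQ
  · cases hPQ
  · obtain ⟨hx, hy⟩ := (some.injEq ..).mp hPQ
    simp only [some.injEq]
    exact ⟨(algebraMap K K').injective hx, (algebraMap K K').injective hy⟩

theorem algebraMap_ofX (p : K[X]) :
    algebraMap W.toAffine.FunctionField (W.map (algebraMap K K')).toAffine.FunctionField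
      (algebraMap _ _ (ofX W.toAffine p)) =
        algebraMap _ _ (ofX (W.map (algebraMap K K')).toAffine (p.map (algebraMap K K'))) := by
  rw [algebraMap_functionField]
  simp only [RingHom.comp_apply]
  rw [CoordinateRing.map_mk, map_C, coe_mapRingHom]

theorem algebraMap_coordY :
    algebraMap W.toAffine.FunctionField (W.map (algebraMap K K')).toAffine.FunctionField
      (algebraMap _ _ (coordY W.toAffine)) =
        algebraMap _ _ (coordY (W.map (algebraMap K K')).toAffine) := by
  rw [algebraMap_functionField, coordY, CoordinateRing.map_mk, map_X]

theorem algebraMap_XClass (x : K) :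
    algebraMap W.toAffine.FunctionField (W.map (algebraMap K K')).toAffine.FunctionField
      (algebraMap _ _ (XClass W.toAffine x)) =
        algebraMap _ _ (XClass (W.map (algebraMap K K')).toAffine (algebraMap K K' x)) := by
  have := algebraMap_ofX K' (W := W) (X - C x)
  rw [Polynomial.map_sub, map_X, map_C] at this
  exact this

theorem algebraMap_YClass (y : K) :
    algebraMap W.toAffine.FunctionField (W.map (algebraMap K K')).toAffine.FunctionField
      (algebraMap _ _ (YClass W.toAffine (C y))) =
        algebraMap _ _ (YClass (W.map (algebraMap K K')).toAffine (C (algebraMap K K' y))) := by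
  have h1 := algebraMap_ofX K' (W := W) (C y)
  have h2 := algebraMap_coordY K' (W := W)
  rw [map_C] at h1
  have e1 : YClass W.toAffine (C y) = coordY W.toAffine - ofX W.toAffine (C y) := by simp [YClass]
  have e2 : YClass (W.map (algebraMap K K')).toAffine (C (algebraMap K K' y)) =
    coordY _ - ofX _ (C (algebraMap K K' y)) := by simp [YClass]
  rw [e1, e2, map_sub, map_sub, h1, h2, map_sub]

variable [FiniteDimensional K K']

/-- Infinity is the only pole of `X` on either curve, and a place is a pole of `X` exactly when its
restriction is, as ramification indices are positive. -/
theorem restrict_eq_infty_iff (P' : Place K' (W.map (algebraMap K K')).toAffine.FunctionField) :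
    P'.restrict K W.toAffine.FunctionField = infty W.toAffine ↔ P' = infty _ := by
  have hX : algebraMap W.toAffine.FunctionField (W.map (algebraMap K K')).toAffine.FunctionField
      (algebraMap _ _ (ofX W.toAffine X)) = algebraMap _ _ (ofX (W.map (algebraMap K K')).toAffine X) := by
    rw [algebraMap_ofX, map_X]
  have h := P'.ord_algebraMap (K := K) (algebraMap_ne_zero W.toAffine (ofX_X_ne_zero W.toAffine))
  rw [hX] at h
  have he : 0 < P'.ramificationIdx K W.toAffine.FunctionField := P'.ramificationIdx_pos
  constructor
  · intro h'
    apply eq_infty_of_ord_X_neg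
    rw [h, h', ord_infty_X]
    exact mul_neg_of_pos_of_neg he (by decide)
  · intro h'
    apply eq_infty_of_ord_X_neg
    have h1 : P'.ord (algebraMap _ _ (ofX (W.map (algebraMap K K')).toAffine X)) < 0 := by rw [h', ord_infty_X]; decide
    rw [h] at h1
    exact neg_of_mul_neg_right h1 he.le

/-- The function `X` has order `-2` at infinity on both curves. -/
theorem ramificationIdx_infty :
    (infty (W.map (algebraMap K K')).toAffine).ramificationIdx K W.toAffine.FunctionField = 1 := by
  have hX : algebraMap W.toAffine.FunctionField (W.map (algebraMap K K')).toAffine.FunctionField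
      (algebraMap _ _ (ofX W.toAffine X)) = algebraMap _ _ (ofX (W.map (algebraMap K K')).toAffine X) := by
    rw [algebraMap_ofX, map_X]
  have h := (infty (W.map (algebraMap K K')).toAffine).ord_algebraMap (K := K)
    (algebraMap_ne_zero W.toAffine (ofX_X_ne_zero W.toAffine))
  rw [hX, (restrict_eq_infty_iff K' _).2 rfl, ord_infty_X, ord_infty_X] at h
  omega

variable [W.IsElliptic]

theorem restrict_eq_place_iff (Q : W.toAffine.Point)
    (P' : Place K' (W.map (algebraMap K K')).toAffine.FunctionField) :
    P'.restrict K W.toAffine.FunctionField = Q.place ↔ P' = (Q.extend K').place := by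
  rcases Q with _ | ⟨x, y, h⟩
  · exact restrict_eq_infty_iff K' P'
  have he : 0 < P'.ramificationIdx K W.toAffine.FunctionField := P'.ramificationIdx_pos
  have h1 := P'.ord_algebraMap (K := K) (algebraMap_ne_zero W.toAffine (XClass_ne_zero x))
  have h2 := P'.ord_algebraMap (K := K) (algebraMap_ne_zero W.toAffine (YClass_ne_zero (C y)))
  rw [algebraMap_XClass] at h1
  rw [algebraMap_YClass] at h2
  refine (ofPrime_prime_iff h.1 _).trans (Iff.trans ?_ (ofPrime_prime_iff
    ((W.toAffine.map_nonsingular (algebraMap K K').injective ..).2 h).1 _).symm)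
  rw [h1, h2, mul_pos_iff_of_pos_left he, mul_pos_iff_of_pos_left he]

/-- At an affine point one of `X - x`, `Y - y` has order one upstairs and is already defined
downstairs, so the ramification index divides one. -/
theorem ramificationIdx_place (Q : W.toAffine.Point) :
    (Q.extend K').place.ramificationIdx K W.toAffine.FunctionField = 1 := by
  rcases Q with _ | ⟨x, y, h⟩
  · exact ramificationIdx_infty K'
  have h' := ((W.toAffine.map_nonsingular (algebraMap K K').injective ..).2 h).1
  change (Place.ofPrime K' _ (prime h')).ramificationIdx K W.toAffine.FunctionField = 1
  set P' := Place.ofPrime K' (W.map (algebraMap K K')).toAffine.FunctionField (prime h') with hP'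
  have he : 0 < P'.ramificationIdx K W.toAffine.FunctionField := P'.ramificationIdx_pos
  have h1 := P'.ord_algebraMap (K := K) (algebraMap_ne_zero W.toAffine (XClass_ne_zero x))
  have h2 := P'.ord_algebraMap (K := K) (algebraMap_ne_zero W.toAffine (YClass_ne_zero (C y)))
  rw [algebraMap_XClass] at h1
  rw [algebraMap_YClass] at h2
  rcases ord_ofPrime_prime_eq_one h' with h3 | h3
  · rw [h3] at h1
    exact Int.eq_one_of_mul_eq_one_right he.le h1.symm
  · rw [h3] at h2
    exact Int.eq_one_of_mul_eq_one_right he.le h2.symm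

theorem clBaseChange_divisorClass [Algebra.IsSeparable K K'] (Q : W.toAffine.Point) :
    W.clBaseChange K' Q.divisorClass = (Q.extend K').divisorClass := by
  change QuotientAddGroup.mk _ = QuotientAddGroup.mk _
  congr 1
  rw [map_sub, pullback_single (restrict_eq_place_iff K' Q) (ramificationIdx_place K' Q),
    pullback_single (restrict_eq_infty_iff K') (ramificationIdx_infty K')]

end

end WeierstrassCurve.Affine.Point

/-! ### Lines through a point of the curve -/

namespace WeierstrassCurve.Affine

section
variable {L : Type*} [Field L] (V : WeierstrassCurve.Affine L)

/-- The sum of the abscissas, with opposite sign, of the other two intersections with the curve of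
the line of slope `m` through a point of abscissa `x₀`. -/
def lineLin (x₀ m : L) : L := x₀ + V.a₂ - m ^ 2 - V.a₁ * m

/-- The product of the abscissas of the other two intersections with the curve of the line of slope
`m` through the point `(x₀, y₀)`. -/
def lineConst (x₀ y₀ m : L) : L :=
  V.a₄ - 2 * m * (y₀ - m * x₀) - V.a₁ * (y₀ - m * x₀) - V.a₃ * m + x₀ * lineLin V x₀ m

/-- The quadratic polynomial whose roots are the abscissas of the other two intersections with the
curve of the line of slope `m` through the point `(x₀, y₀)`. -/
def lineQuad (x₀ y₀ m x : L) : L := x ^ 2 + lineLin V x₀ m * x + lineConst V x₀ y₀ m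

variable {V}

theorem equation_line_iff {x₀ y₀ : L} (h : V.Equation x₀ y₀) (m x : L) :
    V.Equation x (m * (x - x₀) + y₀) ↔ (x - x₀) * lineQuad V x₀ y₀ m x = 0 := by
  rw [equation_iff'] at h ⊢
  have : (m * (x - x₀) + y₀) ^ 2 + V.a₁ * x * (m * (x - x₀) + y₀) + V.a₃ * (m * (x - x₀) + y₀) -
      (x ^ 3 + V.a₂ * x ^ 2 + V.a₄ * x + V.a₆) = -((x - x₀) * lineQuad V x₀ y₀ m x) := by
    rw [lineQuad, lineConst, lineLin]
    linear_combination h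
  rw [this, neg_eq_zero]

/-- By Vieta's formula: `addX` is minus the linear coefficient minus `x`, the reflection under which
the quadratic is invariant. -/
theorem lineQuad_addX (x₀ y₀ m x : L) :
    lineQuad V x₀ y₀ m (V.addX x₀ x m) = lineQuad V x₀ y₀ m x := by
  rw [lineQuad, lineQuad, addX, lineLin]; ring

theorem lineQuad_self (x₀ y₀ m : L) : lineQuad V x₀ y₀ m x₀ =
    3 * x₀ ^ 2 + 2 * V.a₂ * x₀ + V.a₄ - V.a₁ * y₀ - m * (y₀ - V.negY x₀ y₀) := by
  rw [lineQuad, lineConst, lineLin, negY]; ring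

/-- For `x ≠ x₀` this is the slope of a chord. For `x = x₀` the vanishing is the equation of the
tangent slope, and nonsingularity rules out a vertical tangent. -/
theorem slope_of_lineQuad_eq_zero [DecidableEq L] {x₀ y₀ m x : L} (h : V.Nonsingular x₀ y₀)
    (hx : lineQuad V x₀ y₀ m x = 0) :
    V.Equation x (m * (x - x₀) + y₀) ∧ ¬(x₀ = x ∧ y₀ = V.negY x (m * (x - x₀) + y₀)) ∧
      V.slope x₀ x y₀ (m * (x - x₀) + y₀) = m := by
  refine ⟨(equation_line_iff h.1 m x).2 (by rw [hx, mul_zero]), ?_⟩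
  by_cases hx0 : x₀ = x
  · subst hx0
    rw [lineQuad_self] at hx
    have hy : y₀ ≠ V.negY x₀ y₀ := by
      intro hy
      rw [← hy, sub_self, mul_zero, sub_zero] at hx
      rcases ((nonsingular_iff ..).1 h).2 with h1 | h1
      · exact h1 (by linear_combination -hx)
      · exact h1 hy
    rw [sub_self, mul_zero, zero_add]
    refine ⟨fun h' => hy h'.2, ?_⟩
    rw [slope_of_Y_ne rfl hy, div_eq_iff (sub_ne_zero.2 hy)]
    linear_combination hx
  · refine ⟨fun h' => hx0 h'.1, ?_⟩
    rw [slope_of_X_ne hx0, div_eq_iff (sub_ne_zero.2 hx0)]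
    ring

theorem lineQuad_slope_eq_zero [DecidableEq L] {x₀ y₀ x y : L} (h₀ : V.Equation x₀ y₀)
    (h : V.Equation x y) (hne : ¬(x₀ = x ∧ y₀ = V.negY x y)) :
    y = V.slope x₀ x y₀ y * (x - x₀) + y₀ ∧ lineQuad V x₀ y₀ (V.slope x₀ x y₀ y) x = 0 := by
  by_cases hx0 : x₀ = x
  · have hy := (Y_eq_of_X_eq h₀ h hx0).resolve_right fun h' => hne ⟨hx0, h'⟩
    subst hx0 hy
    have hy' : y₀ ≠ V.negY x₀ y₀ := fun h' => hne ⟨rfl, h'⟩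
    refine ⟨by ring, ?_⟩
    rw [lineQuad_self, slope_of_Y_ne rfl hy', div_mul_cancel₀ _ (sub_ne_zero.2 hy'), sub_self]
  · have hy : y = V.slope x₀ x y₀ y * (x - x₀) + y₀ := by
      rw [slope_of_X_ne hx0]
      have := sub_ne_zero.2 hx0
      field_simp
      ring
    refine ⟨hy, ?_⟩
    have h1 := (equation_line_iff h₀ (V.slope x₀ x y₀ y) x).1 (by rw [← hy]; exact h)
    exact (mul_eq_zero.1 h1).resolve_left (sub_ne_zero.2 (Ne.symm hx0))

end

/-! ### Fixed and anti-fixed points, and the norm map -/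

namespace Point

theorem finite_of_field {L : Type*} [Field L] [Finite L] (V : WeierstrassCurve.Affine L) :
    Finite V.Point :=
  Finite.of_injective (β := Option (L × L)) (fun P => match P with
    | 0 => none
    | some x y _ => Option.some (x, y)) <| by
  rintro (_ | ⟨x, y, h⟩) (_ | ⟨x', y', h'⟩) e <;> simp_all

/-- The slope of the line through a point and the point with coordinates `(x₀, y₀)`. -/
def slopeFrom {L : Type*} [Field L] [DecidableEq L] {V : WeierstrassCurve.Affine L} (x₀ y₀ : L) :
    V.Point → L
  -- An arbitrary value: the point at infinity is excluded whenever slopes are counted.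
  | 0 => 0
  | some x y _ => V.slope x₀ x y₀ y

/-- The points `(x₀, y₀)`, `R` and `-(x₀, y₀) - R` have sum zero, so they lie on one line. -/
theorem slopeFrom_sub {L : Type*} [Field L] [DecidableEq L] {V : WeierstrassCurve.Affine L}
    {x₀ y₀ : L} (h₀ : V.Nonsingular x₀ y₀) {R : V.Point} (hR : R ≠ 0)
    (hR' : R ≠ -some x₀ y₀ h₀) :
    slopeFrom x₀ y₀ (-some x₀ y₀ h₀ - R) = slopeFrom x₀ y₀ R := by
  rcases R with _ | ⟨x, y, h⟩
  · exact absurd rfl hR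
  have hne : ¬(x₀ = x ∧ y₀ = V.negY x y) := by
    rintro ⟨rfl, hy⟩
    apply hR'
    rw [neg_some]
    simp only [some.injEq, true_and]
    rw [hy, negY_negY]
  have h1 := lineQuad_slope_eq_zero h₀.1 h.1 hne
  set m := V.slope x₀ x y₀ y with hm
  rw [← neg_add', add_some hne, neg_some]
  change V.slope x₀ _ y₀ _ = m
  rw [← hm, addY, negY_negY, negAddY]
  exact (slope_of_lineQuad_eq_zero h₀ (by rw [lineQuad_addX, h1.2])).2.2

section
universe u v
variable {K : Type u} {L : Type v} [Field K] [Field L] [Algebra K L]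
  (W : WeierstrassCurve K) (σ : L →ₐ[K] L)

/-- The affine points of `S` have fixed abscissa and are fibred over `K`; the final `1` is the point
at infinity. The parameter `s` covers both `σ P = P` and `σ P = -P`. -/
theorem card_sigma_eq [Fintype K] [Finite L] (hfix : ∀ x : L, σ x = x → ∃ k, algebraMap K L k = x)
    [(W⁄L).IsElliptic] (s : L → L → L) (S : (W⁄L).toAffine.Point → Prop) (h0 : S 0)
    (hS : ∀ x y h, S (some x y h) ↔ σ x = x ∧ σ y = s x y) :
    Nat.card {P // S P} = ∑ k : K, Nat.card {y : L // (W⁄L).toAffine.Equation (algebraMap K L k) y ∧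
      σ y = s (algebraMap K L k) y} + 1 := by
  rw [← Nat.card_sigma, ← Finite.card_option]
  symm
  let f : Option ((k : K) × {y : L // (W⁄L).toAffine.Equation (algebraMap K L k) y ∧
      σ y = s (algebraMap K L k) y}) → {P // S P} := fun o => match o with
    | none => ⟨0, h0⟩
    | .some ⟨k, y⟩ => ⟨some (algebraMap K L k) y (equation_iff_nonsingular.1 y.2.1),
        (hS _ _ _).2 ⟨σ.commutes k, y.2.2⟩⟩
  refine Nat.card_congr (Equiv.ofBijective f ⟨?_, ?_⟩)
  · rintro (_ | ⟨k, y⟩) (_ | ⟨k', y'⟩) h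
    · rfl
    · exact absurd (congrArg Subtype.val h) (some_ne_zero _).symm
    · exact absurd (congrArg Subtype.val h) (some_ne_zero _)
    · have h' := congrArg Subtype.val h
      simp only [f, some.injEq] at h'
      obtain ⟨hk, hy⟩ := h'
      obtain rfl := (algebraMap K L).injective hk
      obtain rfl := Subtype.ext hy
      rfl
  · rintro ⟨_ | ⟨x, y, h⟩, hP⟩
    · exact ⟨none, rfl⟩
    · obtain ⟨hx, hy⟩ := (hS _ _ _).1 hP
      obtain ⟨k, rfl⟩ := hfix x hx
      exact ⟨.some ⟨k, y, h.1, hy⟩, rfl⟩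

/-- Over `k` the ordinates are `y₀` and its negative `y₁`, both in `L`, and `σ` permutes them. If
they are distinct, `σ` fixes both or swaps them, and the counts are `2 + 0` or `0 + 2`. If they
coincide, the single ordinate is counted on both sides. -/
theorem card_fibre (hquad : ∀ b c : K, ∃ x : L, x ^ 2 + algebraMap K L b * x + algebraMap K L c = 0)
    (k : K) :
    Nat.card {y : L // (W⁄L).toAffine.Equation (algebraMap K L k) y ∧ σ y = y} +
      Nat.card {y : L // (W⁄L).toAffine.Equation (algebraMap K L k) y ∧
        σ y = (W⁄L).toAffine.negY (algebraMap K L k) y} = 2 := by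
  set V := (W⁄L).toAffine with hV
  have ha₁ : V.a₁ = algebraMap K L W.a₁ := rfl
  have ha₂ : V.a₂ = algebraMap K L W.a₂ := rfl
  have ha₃ : V.a₃ = algebraMap K L W.a₃ := rfl
  have ha₄ : V.a₄ = algebraMap K L W.a₄ := rfl
  have ha₆ : V.a₆ = algebraMap K L W.a₆ := rfl
  set x := algebraMap K L k with hx
  obtain ⟨y₀, hy₀⟩ := hquad (W.a₁ * k + W.a₃) (-(k ^ 3 + W.a₂ * k ^ 2 + W.a₄ * k + W.a₆))
  have h₀ : V.Equation x y₀ := by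
    rw [equation_iff']
    simp only [map_add, map_mul, _root_.map_neg, map_pow] at hy₀
    simp only [ha₁, ha₂, ha₃, ha₄, ha₆]
    linear_combination hy₀
  set y₁ := V.negY x y₀ with hy₁
  have h₁ : V.Equation x y₁ := (equation_neg x y₀).2 h₀
  have hiff : ∀ y, V.Equation x y ↔ y = y₀ ∨ y = y₁ := fun y =>
    ⟨fun h => Y_eq_of_X_eq h h₀ rfl, by rintro (rfl | rfl) <;> assumption⟩
  have hn₀ : V.negY x y₁ = y₀ := negY_negY x y₀
  have hσn : ∀ y, σ (V.negY x y) = V.negY x (σ y) := fun y => by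
    simp only [negY, ha₁, ha₃, map_sub, _root_.map_neg, map_mul, hx, AlgHom.commutes]
  have hσ₀ : σ y₀ = y₀ ∨ σ y₀ = y₁ := by
    rw [← hiff]
    have := congrArg σ hy₀
    simp only [map_add, map_mul, _root_.map_neg, map_pow, AlgHom.commutes, _root_.map_zero] at this
    rw [equation_iff']
    simp only [ha₁, ha₂, ha₃, ha₄, ha₆, hx]
    linear_combination this
  have hA : ∀ p : L → Prop, Nat.card {y : L // V.Equation x y ∧ p y} =
      {y | (y = y₀ ∨ y = y₁) ∧ p y}.ncard := fun p => by
    rw [← Nat.card_coe_set_eq]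
    simp only [hiff]
    rfl
  rw [hA, hA]
  by_cases h01 : y₀ = y₁
  · rw [← h01, or_self_iff] at hσ₀
    have e1 : {y | (y = y₀ ∨ y = y₁) ∧ σ y = y} = {y₀} := by
      ext y
      simp only [← h01, or_self_iff, Set.mem_ofPred_eq, Set.mem_singleton_iff]
      exact ⟨fun h => h.1, by rintro rfl; exact ⟨rfl, hσ₀⟩⟩
    have e2 : {y | (y = y₀ ∨ y = y₁) ∧ σ y = V.negY x y} = {y₀} := by
      ext y
      simp only [← h01, or_self_iff, Set.mem_ofPred_eq, Set.mem_singleton_iff]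
      exact ⟨fun h => h.1, by rintro rfl; exact ⟨rfl, by rw [hσ₀]; exact h01⟩⟩
    rw [e1, e2, Set.ncard_singleton]
  · rcases hσ₀ with h | h
    · have hσ₁ : σ y₁ = y₁ := by rw [hy₁, hσn, h]
      have e1 : {y | (y = y₀ ∨ y = y₁) ∧ σ y = y} = {y₀, y₁} := by
        ext y
        simp only [Set.mem_ofPred_eq, Set.mem_insert_iff, Set.mem_singleton_iff]
        exact ⟨fun h => h.1, by rintro (rfl | rfl) <;> simp [*]⟩
      have e2 : {y | (y = y₀ ∨ y = y₁) ∧ σ y = V.negY x y} = ∅ := by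
        ext y
        simp only [Set.mem_ofPred_eq, Set.mem_empty_iff_false, iff_false]
        rintro ⟨rfl | rfl, h'⟩
        · exact h01 (h.symm.trans h')
        · rw [hσ₁, hn₀] at h'
          exact h01 h'.symm
      rw [e1, e2, Set.ncard_pair h01, Set.ncard_empty]
    · have hσ₁ : σ y₁ = y₀ := by rw [hy₁, hσn, h, hn₀]
      have e1 : {y | (y = y₀ ∨ y = y₁) ∧ σ y = y} = ∅ := by
        ext y
        simp only [Set.mem_ofPred_eq, Set.mem_empty_iff_false, iff_false]
        rintro ⟨rfl | rfl, h'⟩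
        · exact h01 (h'.symm.trans h)
        · exact h01 (hσ₁.symm.trans h')
      have e2 : {y | (y = y₀ ∨ y = y₁) ∧ σ y = V.negY x y} = {y₀, y₁} := by
        ext y
        simp only [Set.mem_ofPred_eq, Set.mem_insert_iff, Set.mem_singleton_iff]
        refine ⟨fun h => h.1, ?_⟩
        rintro (rfl | rfl)
        · exact ⟨Or.inl rfl, h⟩
        · exact ⟨Or.inr rfl, hσ₁.trans hn₀.symm⟩
      rw [e1, e2, Set.ncard_pair h01, Set.ncard_empty]

variable [DecidableEq L]

/-- The points fixed by a Galois automorphism and those sent to their opposites are, together, as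
many as the points of two projective lines. -/
theorem card_fixed_add_card_neg [Finite K] [Finite L]
    (hfix : ∀ x : L, σ x = x → ∃ k, algebraMap K L k = x)
    (hquad : ∀ b c : K, ∃ x : L, x ^ 2 + algebraMap K L b * x + algebraMap K L c = 0)
    [(W⁄L).IsElliptic] :
    Nat.card {P : (W⁄L).toAffine.Point // map σ P = P} +
      Nat.card {P : (W⁄L).toAffine.Point // map σ P = -P} = 2 * (Nat.card K + 1) := by
  have := Fintype.ofFinite K
  rw [card_sigma_eq W σ hfix (fun _ y => y) (fun P => map σ P = P) (map_zero σ) (fun x y h => by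
      rw [map_some, some.injEq]),
    card_sigma_eq W σ hfix (fun x y => (W⁄L).toAffine.negY x y) (fun P => map σ P = -P)
      (by rw [map_zero]; rfl)
      (fun x y h => by rw [map_some, neg_some, some.injEq])]
  have : ∀ a b : ℕ, a + 1 + (b + 1) = a + b + 2 := fun a b => by ring
  rw [this, ← Finset.sum_add_distrib]
  simp only [card_fibre W σ hquad]
  rw [Finset.sum_const, Finset.card_univ, Nat.card_eq_fintype_card]
  simp only [smul_eq_mul]
  ring

/-- If `P` is not twice a fixed point, consider the lines through `-P` with slope in `K`. The other
two intersections have sum `P`. There are too few fixed points to account for all slopes, so on some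
line these intersections are not fixed; they are then conjugate under `σ`, that is, `R` and `σ R`.
-/
theorem exists_add_map_eq [Finite K] [Finite L]
    (hfix : ∀ x : L, σ x = x → ∃ k, algebraMap K L k = x)
    (hquad : ∀ b c : K, ∃ x : L, x ^ 2 + algebraMap K L b * x + algebraMap K L c = 0)
    [(W⁄L).IsElliptic] {P : (W⁄L).toAffine.Point} (hP : map σ P = P) :
    ∃ R : (W⁄L).toAffine.Point, R + map σ R = P := by
  classical
  have := finite_of_field (W⁄L).toAffine
  by_cases h2 : ∃ R : (W⁄L).toAffine.Point, map σ R = R ∧ R + R = P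
  · obtain ⟨R, hR, hRR⟩ := h2
    exact ⟨R, by rw [hR, hRR]⟩
  push Not at h2
  obtain ⟨Q, rfl⟩ : ∃ Q : (W⁄L).toAffine.Point, P = -Q := ⟨-P, (neg_neg P).symm⟩
  rcases Q with _ | ⟨x₀, y₀, h₀⟩
  · exact absurd rfl (h2 0 (map_zero σ))
  have hQσ : σ x₀ = x₀ ∧ σ y₀ = y₀ := by
    rw [map_neg, neg_inj, map_some, some.injEq] at hP
    exact hP
  set P := -some x₀ y₀ h₀ with hPdef
  -- The point at infinity is its own opposite, so at least one of the `2 (q + 1)` points counted is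
  -- on the other side.
  have hcard : Nat.card {R : (W⁄L).toAffine.Point // map σ R = R} ≤ 2 * Nat.card K + 1 := by
    have h := card_fixed_add_card_neg W σ hfix hquad
    have : Finite {P : (W⁄L).toAffine.Point // map σ P = -P} := inferInstance
    have : 0 < Nat.card {P : (W⁄L).toAffine.Point // map σ P = -P} :=
      Nat.card_pos_iff.2 ⟨⟨0, by rw [map_zero]; rfl⟩, this⟩
    change Nat.card {R : (W⁄L).toAffine.Point // map σ R = R} + _ = _ at h
    omega
  have : Fintype K := Fintype.ofFinite K
  have : Fintype (W⁄L).toAffine.Point := Fintype.ofFinite _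
  let S : Finset (W⁄L).toAffine.Point := Finset.univ.filter fun R => map σ R = R ∧ R ≠ 0 ∧ R ≠ P
  have hP0 : P ≠ 0 := by
    rw [hPdef, neg_some]
    exact some_ne_zero _
  have hS : S.card + 2 ≤ 2 * Nat.card K + 1 := by
    refine le_trans (le_of_eq ?_) hcard
    rw [Nat.card_eq_fintype_card, Fintype.card_subtype]
    have h1 : S = ((Finset.univ.filter fun R : (W⁄L).toAffine.Point => map σ R = R).erase 0).erase P := by
      ext R
      simp only [S, Finset.mem_filter, Finset.mem_univ, true_and, Finset.mem_erase]
      tauto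
    have h3 : (0 : (W⁄L).toAffine.Point) ∈ Finset.univ.filter fun R : (W⁄L).toAffine.Point => map σ R = R := by
      simp
    have h4 : P ∈ (Finset.univ.filter fun R : (W⁄L).toAffine.Point => map σ R = R).erase 0 := by
      exact Finset.mem_erase.2 ⟨hP0, Finset.mem_filter.2 ⟨Finset.mem_univ _, hP⟩⟩
    rw [h1, ← Finset.card_erase_add_one h3, ← Finset.card_erase_add_one h4]
  -- Each slope that occurs comes from `R` and from `P - R`, which are distinct since `P` is not `R
  -- + R`.
  have himage : 2 * (S.image (slopeFrom x₀ y₀)).card ≤ S.card := by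
    refine Finset.mul_card_image_le_card S 2 fun m hm => ?_
    obtain ⟨R, hR, rfl⟩ := Finset.mem_image.1 hm
    have hR' := hR
    simp only [S, Finset.mem_filter, Finset.mem_univ, true_and] at hR'
    have hne : R ≠ P - R := fun h => h2 R hR'.1 (by nth_rw 2 [h]; exact add_sub_cancel R P)
    rw [← Finset.card_pair hne]
    refine Finset.card_le_card ?_
    intro Q hQ
    rw [Finset.mem_insert, Finset.mem_singleton] at hQ
    rw [Finset.mem_filter]
    rcases hQ with rfl | rfl
    · exact ⟨hR, rfl⟩
    · refine ⟨?_, slopeFrom_sub h₀ hR'.2.1 hR'.2.2⟩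
      simp only [S, Finset.mem_filter, Finset.mem_univ, true_and]
      refine ⟨by rw [map_sub, hP, hR'.1], fun h => hR'.2.2 (sub_eq_zero.1 h).symm, fun h => ?_⟩
      exact hR'.2.1 (sub_eq_self.1 h)
  -- At most `(2q - 1) / 2` slopes occur, fewer than the `q` elements of `K`.
  obtain ⟨k, hk⟩ : ∃ k : K, algebraMap K L k ∉ S.image (slopeFrom x₀ y₀) := by
    by_contra! hcon
    have h := Finset.card_le_card (s := Finset.univ.image (algebraMap K L))
      (t := S.image (slopeFrom x₀ y₀)) (by
        intro x hx
        obtain ⟨k, -, rfl⟩ := Finset.mem_image.1 hx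
        exact hcon k)
    rw [Finset.card_image_of_injective _ (algebraMap K L).injective, Finset.card_univ,
      ← Nat.card_eq_fintype_card] at h
    omega
  set m := algebraMap K L k with hm
  have hσm : σ m = m := σ.commutes k
  obtain ⟨b, hb⟩ : ∃ b, algebraMap K L b = lineLin (W⁄L).toAffine x₀ m := by
    refine hfix _ ?_
    have h1 : σ (W⁄L).toAffine.a₁ = (W⁄L).toAffine.a₁ := σ.commutes _
    have h3 : σ (W⁄L).toAffine.a₂ = (W⁄L).toAffine.a₂ := σ.commutes _
    simp only [lineLin, map_add, map_sub, map_mul, map_pow, hQσ, hσm, h1, h3]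
  obtain ⟨c, hc⟩ : ∃ c, algebraMap K L c = lineConst (W⁄L).toAffine x₀ y₀ m := by
    refine hfix _ ?_
    have h1 : σ (W⁄L).toAffine.a₁ = (W⁄L).toAffine.a₁ := σ.commutes _
    have h3 : σ (W⁄L).toAffine.a₃ = (W⁄L).toAffine.a₃ := σ.commutes _
    have h4 : σ (W⁄L).toAffine.a₄ = (W⁄L).toAffine.a₄ := σ.commutes _
    rw [lineConst, ← hb]
    simp only [map_add, map_sub, map_mul, map_ofNat, hQσ, hσm, h1, h3, h4, AlgHom.commutes]
  obtain ⟨x₁, hx₁⟩ := hquad b c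
  have hσx₁ := congrArg σ hx₁
  simp only [map_add, map_mul, map_pow, AlgHom.commutes, _root_.map_zero] at hσx₁
  rw [hb, hc] at hx₁ hσx₁
  obtain ⟨heq, hne, hslope⟩ := slope_of_lineQuad_eq_zero h₀ hx₁
  set y₁ := m * (x₁ - x₀) + y₀ with hy₁
  have hσy₁ : σ y₁ = m * (σ x₁ - x₀) + y₀ := by
    simp only [hy₁, map_add, map_mul, map_sub, hQσ, hσm]
  let R : (W⁄L).toAffine.Point := some x₁ y₁ (equation_iff_nonsingular.1 heq)
  have hσR : map σ R = some (σ x₁) (σ y₁)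
    (by rw [hσy₁]; exact equation_iff_nonsingular.1 (slope_of_lineQuad_eq_zero h₀ hσx₁).1) := map_some ..
  -- Otherwise `R` would be a fixed point in `S` with the slope `k` that was chosen not to occur.
  have hfixed : σ x₁ ≠ x₁ := by
    intro h
    refine hk (Finset.mem_image.2 ⟨R, ?_, hslope⟩)
    simp only [S, Finset.mem_filter, Finset.mem_univ, true_and]
    refine ⟨?_, some_ne_zero _, fun h' => hne ?_⟩
    · rw [hσR, some.injEq]
      exact ⟨h, by rw [hσy₁, h]⟩
    · rw [hPdef, neg_some, some.injEq] at h'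
      refine ⟨h'.1.symm, ?_⟩
      rw [h'.1, h'.2, negY_negY]
  -- Both `x₁` and `σ x₁` are roots of the same quadratic, and they are distinct, so they are all
  -- its roots.
  have hsum : x₁ + σ x₁ = -lineLin (W⁄L).toAffine x₀ m := by
    have h : (x₁ - σ x₁) * (x₁ + σ x₁ + lineLin (W⁄L).toAffine x₀ m) = 0 := by linear_combination hx₁ - hσx₁
    exact eq_neg_of_add_eq_zero_left
      ((mul_eq_zero.1 h).resolve_left (sub_ne_zero.2 (Ne.symm hfixed)))
  have hslope' : (W⁄L).toAffine.slope x₁ (σ x₁) y₁ (σ y₁) = m := by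
    rw [slope_of_X_ne (Ne.symm hfixed), div_eq_iff (sub_ne_zero.2 (Ne.symm hfixed)), hσy₁, hy₁]
    ring
  have haddX : (W⁄L).toAffine.addX x₁ (σ x₁) m = x₀ := by
    rw [lineLin] at hsum
    rw [addX]
    linear_combination -hsum
  refine ⟨R, ?_⟩
  rw [hσR, add_of_X_ne (Ne.symm hfixed), hPdef, neg_some, some.injEq, hslope', addY, negAddY, haddX]
  refine ⟨rfl, congrArg _ ?_⟩
  rw [hy₁]
  ring

end
end Point

end WeierstrassCurve.Affine

/-! ### The quadratic extension of a finite field -/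

namespace FiniteField

/-- The elements of `K` already exhaust the roots of `X ^ q - X`, which number at most `q`. -/
theorem exists_algebraMap_eq_of_frobeniusAlgHom_eq {K L : Type*} [Field K] [Fintype K] [Field L]
    [Algebra K L] {x : L} (hx : frobeniusAlgHom K L x = x) :
    ∃ k, algebraMap K L k = x := by
  classical
  by_contra! hcon
  have hne : (X ^ Fintype.card K - X : L[X]) ≠ 0 :=
    X_pow_card_sub_X_ne_zero L Fintype.one_lt_card
  have h1 : insert x (Finset.univ.image (algebraMap K L)) ⊆
      (X ^ Fintype.card K - X : L[X]).roots.toFinset := by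
    intro y hy
    rw [Multiset.mem_toFinset, mem_roots hne, IsRoot.def, eval_sub, eval_pow, eval_X, sub_eq_zero]
    rcases Finset.mem_insert.1 hy with rfl | hy
    · exact hx
    · obtain ⟨k, -, rfl⟩ := Finset.mem_image.1 hy
      rw [← map_pow, FiniteField.pow_card]
  have h2 := (Finset.card_le_card h1).trans ((Multiset.toFinset_card_le _).trans (card_roots' _))
  rw [Finset.card_insert_of_notMem (by simpa using hcon),
    Finset.card_image_of_injective _ (algebraMap K L).injective, Finset.card_univ,
    X_pow_card_sub_X_natDegree_eq L Fintype.one_lt_card] at h2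
  omega

/-- An irreducible quadratic defines an extension of degree two, which embeds in `L` by uniqueness
of finite fields; a reducible one has a root in `K`. -/
theorem exists_quadratic_root {K L : Type*} [Field K] [Field L] [Algebra K L] [Finite L] (h : Module.finrank K L = 2) (b c : K) :
    ∃ x : L, x ^ 2 + algebraMap K L b * x + algebraMap K L c = 0 := by
  set p : K[X] := X ^ 2 + C b * X + C c with hp
  have hdeg : p.natDegree = 2 := by rw [hp]; compute_degree!
  suffices ∃ x : L, aeval x p = 0 by
    obtain ⟨x, hx⟩ := this
    exact ⟨x, by simpa [hp] using hx⟩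
  by_cases hirr : Irreducible p
  · have := Fact.mk hirr
    have hfin : Module.finrank K (AdjoinRoot p) = 2 :=
      (AdjoinRoot.powerBasis hirr.ne_zero).finrank.trans hdeg
    obtain ⟨φ⟩ := nonempty_algHom_of_finrank_dvd (F := K) (K := AdjoinRoot p) (L := L)
      (by rw [hfin, h])
    refine ⟨φ (AdjoinRoot.root p), ?_⟩
    rw [aeval_algHom_apply, AdjoinRoot.aeval_eq, AdjoinRoot.mk_self, map_zero]
  · rw [irreducible_iff_roots_eq_zero_of_degree_le_three hdeg.ge (by omega)] at hirr
    obtain ⟨k, hk⟩ := Multiset.exists_mem_of_ne_zero hirr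
    refine ⟨algebraMap K L k, ?_⟩
    rw [aeval_algebraMap_apply, aeval_def, Algebra.algebraMap_self, ← eval, (mem_roots'.1 hk).2,
      map_zero]

end FiniteField

/-! ### Counting points over the quadratic extension -/

namespace WeierstrassCurve.Affine.Point

section
universe u v
variable {K : Type u} {L : Type v} [Field K] [Field L] [Algebra K L] (W : WeierstrassCurve K)
  (σ : L →ₐ[K] L) [DecidableEq L]

theorem card_fixed_eq (hfix : ∀ x : L, σ x = x → ∃ k, algebraMap K L k = x) :
    Nat.card {P : (W⁄L).toAffine.Point // map σ P = P} = Nat.card W.toAffine.Point := by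
  symm
  refine Nat.card_congr (Equiv.ofBijective (fun Q => ⟨extend L Q, ?_⟩) ⟨?_, ?_⟩)
  · rcases Q with _ | ⟨x, y, h⟩
    · rfl
    · have h' : (W⁄L).toAffine.Nonsingular (algebraMap K L x) (algebraMap K L y) :=
        (W.toAffine.map_nonsingular (algebraMap K L).injective ..).2 h
      change map σ (some _ _ h') = some _ _ h'
      rw [map_some, some.injEq]
      exact ⟨σ.commutes x, σ.commutes y⟩
  · intro Q Q' h
    exact extend_injective L (congrArg Subtype.val h)
  · rintro ⟨_ | ⟨x, y, h⟩, hP⟩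
    · exact ⟨0, rfl⟩
    · rw [map_some, some.injEq] at hP
      obtain ⟨x, rfl⟩ := hfix x hP.1
      obtain ⟨y, rfl⟩ := hfix y hP.2
      exact ⟨some x y ((W.toAffine.map_nonsingular (algebraMap K L).injective ..).1 h), rfl⟩

/-- The two factors are the orders of the image and the kernel of `1 + σ`. The image consists of
fixed points because `σ` is an involution, and contains all of them by `exists_add_map_eq`. -/
theorem card_fixed_mul_card_neg [Finite K] [Finite L] (hσ : ∀ x, σ (σ x) = x)
    (hfix : ∀ x : L, σ x = x → ∃ k, algebraMap K L k = x)
    (hquad : ∀ b c : K, ∃ x : L, x ^ 2 + algebraMap K L b * x + algebraMap K L c = 0)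
    [(W⁄L).IsElliptic] :
    Nat.card {P : (W⁄L).toAffine.Point // map σ P = P} *
      Nat.card {P : (W⁄L).toAffine.Point // map σ P = -P} = Nat.card (W⁄L).toAffine.Point := by
  let τ : (W⁄L).toAffine.Point →+ (W⁄L).toAffine.Point := AddMonoidHom.id _ + map σ
  have hmap : ∀ P : (W⁄L).toAffine.Point, map σ (map σ P) = P := by
    rintro (_ | ⟨x, y, h⟩)
    · rfl
    · rw [map_some, map_some, some.injEq]
      exact ⟨hσ x, hσ y⟩
  have hrange : Nat.card τ.range = Nat.card {P : (W⁄L).toAffine.Point // map σ P = P} := by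
    refine Nat.card_congr (Equiv.subtypeEquivRight fun P => ?_)
    rw [AddMonoidHom.mem_range]
    constructor
    · rintro ⟨R, rfl⟩
      change map σ (R + map σ R) = R + map σ R
      rw [map_add, hmap, add_comm]
    · exact exists_add_map_eq W σ hfix hquad
  have hker : Nat.card τ.ker = Nat.card {P : (W⁄L).toAffine.Point // map σ P = -P} := by
    refine Nat.card_congr (Equiv.subtypeEquivRight fun P => ?_)
    rw [AddMonoidHom.mem_ker]
    change P + map σ P = 0 ↔ _
    rw [add_comm, add_eq_zero_iff_eq_neg]
  rw [← hrange, ← hker, ← AddSubgroup.index_ker, mul_comm, AddSubgroup.card_mul_index]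

end

/-- The number of points of an elliptic curve over the quadratic extension of a finite field. -/
theorem card_mul_eq_card_map {K K' : Type*} [Field K] [Finite K] [Field K'] [Finite K'] [Algebra K K']
    (hK : Nat.card K' = Nat.card K ^ 2) (W : WeierstrassCurve K) [W.IsElliptic] :
    ∃ t : ℕ, Nat.card W.toAffine.Point + t = 2 * (Nat.card K + 1) ∧
      Nat.card W.toAffine.Point * t = Nat.card (W.map (algebraMap K K')).toAffine.Point := by
  classical
  have := Fintype.ofFinite K
  have := Fintype.ofFinite K'
  have hfin : Module.finrank K K' = 2 := by
    have h := Module.card_eq_pow_finrank (K := K) (V := K')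
    rw [← Nat.card_eq_fintype_card, ← Nat.card_eq_fintype_card, hK] at h
    exact (Nat.pow_right_injective Finite.one_lt_card h).symm
  have hσ : ∀ x, FiniteField.frobeniusAlgHom K K' (FiniteField.frobeniusAlgHom K K' x) = x := by
    intro x
    simp only [FiniteField.coe_frobeniusAlgHom]
    rw [← pow_mul, ← sq, ← Nat.card_eq_fintype_card, ← hK, Nat.card_eq_fintype_card,
      FiniteField.pow_card]
  have hfix := fun x : K' =>
    FiniteField.exists_algebraMap_eq_of_frobeniusAlgHom_eq (K := K) (x := x)
  have hquad := FiniteField.exists_quadratic_root hfin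
  have : (W⁄K').IsElliptic := inferInstanceAs (W.map (algebraMap K K')).IsElliptic
  refine ⟨Nat.card {P : (W⁄K').toAffine.Point //
    map (FiniteField.frobeniusAlgHom K K') P = -P}, ?_, ?_⟩
  · rw [← card_fixed_eq W _ hfix, card_fixed_add_card_neg W _ hfix hquad]
  · rw [← card_fixed_eq W _ hfix, card_fixed_mul_card_neg W _ hσ hfix hquad]
    rfl

end WeierstrassCurve.Affine.Point

/-! ### Class numbers and the index -/

namespace WeierstrassCurve

open WeierstrassCurve.Affine

theorem map_clBaseChange_le {K : Type*} (K' : Type*) [Field K] [Field K'] [Algebra K K']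
    [FiniteDimensional K K'] [Algebra.IsSeparable K K'] (W : WeierstrassCurve K) [W.IsElliptic] :
    W.ClZero.map (W.clBaseChange K') ≤ (W.map (algebraMap K K')).ClZero := by
  rintro _ ⟨c, hc, rfl⟩
  obtain ⟨Q, rfl⟩ := Point.exists_divisorClass_eq hc
  rw [Point.clBaseChange_divisorClass]
  exact Point.divisorClass_mem _

theorem clBaseChange_injOn {K : Type*} (K' : Type*) [Field K] [Field K'] [Algebra K K']
    [FiniteDimensional K K'] [Algebra.IsSeparable K K'] (W : WeierstrassCurve K) [W.IsElliptic] :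
    Set.InjOn (W.clBaseChange K') W.ClZero := by
  intro c hc c' hc' h
  obtain ⟨Q, rfl⟩ := Point.exists_divisorClass_eq hc
  obtain ⟨Q', rfl⟩ := Point.exists_divisorClass_eq hc'
  rw [Point.clBaseChange_divisorClass, Point.clBaseChange_divisorClass] at h
  rw [Point.extend_injective K' (Point.divisorClass_injective h)]

theorem card_clZero {K : Type*} [Field K] (W : WeierstrassCurve K) [W.IsElliptic] :
    Nat.card W.ClZero = Nat.card W.toAffine.Point :=
  (Nat.card_congr Point.equivClassGroupZero).symm

theorem finite_clZero {K : Type*} [Field K] [Finite K] (W : WeierstrassCurve K) [W.IsElliptic] :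
    Finite W.ClZero :=
  have := Point.finite_of_field W.toAffine
  Finite.of_equiv _ (Point.equivClassGroupZero (W := W.toAffine))

end WeierstrassCurve

theorem AddSubgroup.card_quotient_map_mul_card {G G' : Type*} [AddCommGroup G] [AddCommGroup G']
    {H : AddSubgroup G} {H' : AddSubgroup G'} {f : G →+ G'} (hle : H.map f ≤ H')
    (hinj : Set.InjOn f H) :
    Nat.card (H' ⧸ (H.map f).addSubgroupOf H') * Nat.card H = Nat.card H' := by
  have hsub : Nat.card ((H.map f).addSubgroupOf H') = Nat.card H := by
    rw [Nat.card_congr (AddSubgroup.addSubgroupOfEquivOfLe hle).toEquiv]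
    exact Nat.card_image_of_injOn hinj
  rw [AddSubgroup.card_eq_card_quotient_mul_card_addSubgroup ((H.map f).addSubgroupOf H'), hsub]

theorem lemmah {K K' : Type*} [Field K] [Finite K] [Field K'] [Finite K'] [Algebra K K']
    (hK : Nat.card K' = Nat.card K ^ 2) (W : WeierstrassCurve K) [W.IsElliptic] :
    W.ClZero.map (W.clBaseChange K') ≤ (W.map (algebraMap K K')).ClZero ∧
    Set.InjOn (W.clBaseChange K') W.ClZero ∧
    Finite W.ClZero ∧
    Finite ((W.map (algebraMap K K')).ClZero ⧸
      (W.ClZero.map (W.clBaseChange K')).addSubgroupOf (W.map (algebraMap K K')).ClZero) ∧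
    (Nat.card ((W.map (algebraMap K K')).ClZero ⧸
      (W.ClZero.map (W.clBaseChange K')).addSubgroupOf (W.map (algebraMap K K')).ClZero) : ℤ) =
      2 * ((Nat.card K : ℤ) + 1) - (Nat.card W.ClZero : ℤ) := by
  have hle := W.map_clBaseChange_le K'
  have hinj := W.clBaseChange_injOn K'
  have hfin := W.finite_clZero
  have hfin' := (W.map (algebraMap K K')).finite_clZero
  refine ⟨hle, hinj, hfin, inferInstance, ?_⟩
  obtain ⟨t, hadd, hmul⟩ := WeierstrassCurve.Affine.Point.card_mul_eq_card_map hK W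
  rw [← W.card_clZero, ← WeierstrassCurve.card_clZero, mul_comm,
    ← AddSubgroup.card_quotient_map_mul_card hle hinj] at hmul
  rw [← W.card_clZero] at hadd
  -- The number `t` and the index both become the order of the class group upstairs when multiplied
  -- by the positive number `h`, so they are equal.
  rw [← Nat.eq_of_mul_eq_mul_right Nat.card_pos hmul]
  omega
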